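/- All matroids and oriented matroids are finite. **Definitions.** A matroid is *simple* if it has no circuit with at most two elements, and *cosimple* if its dual is simple; it is *orientable* if it is the underlying matroid of an oriented matroid $O$, and such an $O$ is called an *orientation* of it. A *flow* (*coflow*) of an oriented matroid $O$ is an integer combination of the $\{0,1,-1\}$-vectors of the signed circuits (signed cocircuits) of $O$. We call $O$ *coGSP* if every minor of $O$ on a nonempty ground set whose underlying matroid is cosimple has a $\{0,1,-1\}$-valued flow with exactly one or two nonzero entries, and *GSP* if every minor of $O$ on a nonempty ground set whose underlying matroid is simple has a $\{0,1,-1\}$-valued coflow with exactly one or two nonzero entries. A *double circuit* of a matroid $M$ with rank function $r$ is a set $D\subseteq E(M)$ with $r(D)=|D|-2$ and $r(D\setminus\{d\})=r(D)$ for all $d\in D$. Its *classes* are the sets $D\setminus C$, where $C$ is a circuit of $M$ contained in $D$ (they partition $D$). A *coline* of $M$ is a flat $L$ of rank $r(M)-2$; its *classes* are the sets $H\setminus L$, where $H\supseteq L$ is a flat of rank $r(M)-1$ (they partition $E(M)\setminus L$). In both cases the *degree* is the number of classes, and a class is *singular* if it has exactly one element. **Proposition 4.4 and its dual.** Let $\mathcal{C}$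 be a minor-closed class of orientable matroids. 1. If every cosimple matroid in $\mathcal{C}$ of corank at least two has a double circuit that either has even degree and at least one singular class, or has odd degree and at least two singular classes, then every orientation of a matroid in $\mathcal{C}$ is coGSP. 2. If every simple matroid in $\mathcal{C}$ of rank at least two has a coline that either has even degree and at least one singular class, or has odd degree and at least two singular classes, then every orientation of a matroid in $\mathcal{C}$ is GSP. -/

import Mathlib

open Set

universe u

/-! ## Oriented matroids (finite, by signed circuits) -/

/-- A (finite) oriented matroid on a ground set `E ⊆ α`, given by its signed circuits.
A signed set is a function `X : α → SignType`; its positive part is `{e | X e = 1}`, its negative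
part is `{e | X e = -1}`, and its underlying set is `Function.support X`.
The axioms are the usual (weak) signed circuit axioms. -/
structure OrientedMatroid (α : Type u) where
  /-- the ground set -/
  E : Set α
  finite_ground : E.Finite
  /-- the signed circuits -/
  circuits : Set (α → SignType)
  support_subset_ground : ∀ X ∈ circuits, Function.support X ⊆ E
  ne_zero : ∀ X ∈ circuits, X ≠ 0
  neg_mem : ∀ X ∈ circuits, -X ∈ circuits
  eq_or_eq_neg : ∀ X ∈ circuits, ∀ Y ∈ circuits,
    Function.support X ⊆ Function.support Y → X = Y ∨ X = -Y
  elimination : ∀ X ∈ circuits, ∀ Y ∈ circuits, X ≠ -Y → ∀ e, X e = 1 → Y e = -1 →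
    ∃ Z ∈ circuits, Z e = 0 ∧
      (∀ f, Z f = 1 → X f = 1 ∨ Y f = 1) ∧ (∀ f, Z f = -1 → X f = -1 ∨ Y f = -1)

namespace OrientedMatroid

variable {α : Type u}

theorem support_neg_sign (X : α → SignType) : Function.support (-X) = Function.support X := by
  have key : ∀ s : SignType, -s ≠ 0 ↔ s ≠ 0 := by decide
  ext f
  exact key (X f)

/-- Elimination in a form symmetric in the sign of the eliminated element. -/
theorem elimination' (O : OrientedMatroid α) {X Y : α → SignType} (hX : X ∈ O.circuits)
    (hY : Y ∈ O.circuits) (hXY : X ≠ -Y) {e : α} (he : X e ≠ 0) (hYe : Y e = -X e) :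
    ∃ Z ∈ O.circuits, Z e = 0 ∧ ∀ f, Z f ≠ 0 → Z f = X f ∨ Z f = Y f := by
  have key : ∀ s : SignType, s ≠ 0 → s = 1 ∨ s = -1 := by decide
  rcases key _ he with h | h
  · obtain ⟨Z, hZ, hZe, hp, hn⟩ := O.elimination X hX Y hY hXY e h (by rw [hYe, h])
    refine ⟨Z, hZ, hZe, fun f hf ↦ ?_⟩
    rcases key _ hf with h' | h'
    · rcases hp f h' with h1 | h1 <;> simp [h', h1]
    · rcases hn f h' with h1 | h1 <;> simp [h', h1]
  · obtain ⟨Z, hZ, hZe, hp, hn⟩ := O.elimination Y hY X hX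
      (fun h' ↦ hXY (by rw [h', neg_neg])) e (by rw [hYe, h]; rfl) h
    refine ⟨Z, hZ, hZe, fun f hf ↦ ?_⟩
    rcases key _ hf with h' | h'
    · rcases hp f h' with h1 | h1 <;> simp [h', h1]
    · rcases hn f h' with h1 | h1 <;> simp [h', h1]

/-- The underlying sets of the signed circuits satisfy circuit elimination. -/
theorem support_elimination (O : OrientedMatroid α) {X Y : α → SignType} (hX : X ∈ O.circuits)
    (hY : Y ∈ O.circuits) (hXY : Function.support X ≠ Function.support Y) {e : α}
    (he : X e ≠ 0) (he' : Y e ≠ 0) :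
    ∃ Z ∈ O.circuits,
      Function.support Z ⊆ (Function.support X ∪ Function.support Y) \ {e} := by
  have main : ∀ Y' ∈ O.circuits, Function.support Y' = Function.support Y → Y' e = -X e →
      ∃ Z ∈ O.circuits,
        Function.support Z ⊆ (Function.support X ∪ Function.support Y) \ {e} := by
    intro Y' hY' hs h
    obtain ⟨Z, hZ, hZe, hf⟩ := O.elimination' hX hY'
      (fun h' ↦ hXY (by rw [h', support_neg_sign, hs])) he h
    refine ⟨Z, hZ, fun f hfZ ↦ ⟨?_, ?_⟩⟩
    · rw [← hs]
      rcases hf f hfZ with h1 | h1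
      · left; rw [Function.mem_support, ← h1]; exact hfZ
      · right; rw [Function.mem_support, ← h1]; exact hfZ
    · rintro rfl; exact hfZ hZe
  have key : ∀ s t : SignType, s ≠ 0 → t ≠ 0 → t = -s ∨ -t = -s := by decide
  rcases key _ _ he he' with h | h
  · exact main Y hY rfl h
  · exact main (-Y) (O.neg_mem Y hY) (support_neg_sign Y) h

/-- `O.Indep I`: the set `I ⊆ E` contains the underlying set of no signed circuit. -/
def Indep (O : OrientedMatroid α) (I : Set α) : Prop :=
  I ⊆ O.E ∧ ∀ X ∈ O.circuits, ¬ Function.support X ⊆ I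

theorem Indep.subset {O : OrientedMatroid α} {I J : Set α} (hJ : O.Indep J) (h : I ⊆ J) :
    O.Indep I :=
  ⟨h.trans hJ.1, fun X hX hs ↦ hJ.2 X hX (hs.trans h)⟩

theorem exists_circuit_of_not_indep {O : OrientedMatroid α} {I : Set α} (hI : I ⊆ O.E)
    (h : ¬ O.Indep I) : ∃ X ∈ O.circuits, Function.support X ⊆ I := by
  by_contra hcon
  push Not at hcon
  exact h ⟨hI, hcon⟩

theorem indep_aug (O : OrientedMatroid α) {I J : Set α} (hI : O.Indep I) (hJ : O.Indep J)
    (hlt : I.ncard < J.ncard) : ∃ e ∈ J, e ∉ I ∧ O.Indep (insert e I) := by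
  by_contra hcon
  push Not at hcon
  have hfin : ∀ {S : Set α}, S ⊆ O.E → S.Finite := fun h ↦ O.finite_ground.subset h
  -- choose a larger independent set in the union that contains as much of `I` as possible
  let P : Set (Set α) := {K | O.Indep K ∧ K ⊆ I ∪ J ∧ I.ncard < K.ncard}
  have hPne : P.Nonempty := ⟨J, hJ, subset_union_right, hlt⟩
  obtain ⟨K, ⟨hK, hKIJ, hKI⟩, hmin⟩ :
      ∃ K ∈ P, ∀ K' ∈ P, (I \ K).ncard ≤ (I \ K').ncard := by
    obtain ⟨K, hK, h⟩ := (InvImage.wf (fun K : Set α ↦ (I \ K).ncard)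
      Nat.lt_wfRel.wf).has_min P hPne
    exact ⟨K, hK, fun K' hK' ↦ not_lt.1 (h K' hK')⟩
  have hIfin := hfin hI.1
  have hKfin := hfin hK.1
  obtain ⟨g, hgK, hgI⟩ : ∃ g ∈ K, g ∉ I := by
    by_contra! h
    exact absurd (ncard_le_ncard (show K ⊆ I from h) hIfin) (not_le.2 hKI)
  obtain ⟨e, heI, heK⟩ : ∃ e ∈ I, e ∉ K := by
    by_contra! h
    have hgJ : g ∈ J := (hKIJ hgK).resolve_left hgI
    exact hcon g hgJ hgI (hK.subset (insert_subset hgK h))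
  -- exchanging an element of `K \ I` for `e` gives a dependent set
  have hC : ∀ f ∈ K, f ∉ I → ∃ X ∈ O.circuits, Function.support X ⊆ insert e (K \ {f}) ∧
      X e ≠ 0 := by
    intro f hfK hfI
    have hsub : insert e (K \ {f}) ⊆ O.E :=
      insert_subset (hI.1 heI) (sdiff_subset.trans hK.1)
    have hdep : ¬ O.Indep (insert e (K \ {f})) := by
      intro hind
      have hcard : (insert e (K \ {f})).ncard = K.ncard := by
        rw [ncard_insert_of_notMem (fun h ↦ heK h.1) (hKfin.subset sdiff_subset),
          ncard_sdiff_singleton_add_one hfK hKfin]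
      have h1 := hmin (insert e (K \ {f})) ⟨hind,
        insert_subset (Or.inl heI) (sdiff_subset.trans hKIJ), by rw [hcard]; exact hKI⟩
      refine absurd (ncard_lt_ncard (s := I \ insert e (K \ {f})) (t := I \ K) ?_
        (hIfin.subset sdiff_subset)) (not_lt.2 h1)
      refine ⟨fun x hx ↦ ⟨hx.1, fun hxK ↦ hx.2 (Or.inr ⟨hxK, ?_⟩)⟩, fun h ↦ ?_⟩
      · rintro rfl; exact hfI hx.1
      · exact (h ⟨heI, heK⟩).2 (Or.inl rfl)
    obtain ⟨X, hX, hXs⟩ := exists_circuit_of_not_indep hsub hdep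
    refine ⟨X, hX, hXs, fun h0 ↦ hK.2 X hX fun x hx ↦ ?_⟩
    rcases hXs hx with rfl | h
    · exact absurd h0 hx
    · exact h.1
  obtain ⟨X, hX, hXs, hXe⟩ := hC g hgK hgI
  obtain ⟨h, hhX, hhI⟩ : ∃ h, X h ≠ 0 ∧ h ∉ I := by
    by_contra! hh
    exact hI.2 X hX hh
  have hhK : h ∈ K := by
    rcases hXs hhX with rfl | h1
    · exact absurd heI hhI
    · exact h1.1
  obtain ⟨Y, hY, hYs, hYe⟩ := hC h hhK hhI
  have hne : Function.support X ≠ Function.support Y := by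
    intro heq
    have hhY : h ∈ Function.support Y := heq ▸ hhX
    rcases hYs hhY with rfl | h1
    · exact hhI heI
    · exact h1.2 rfl
  obtain ⟨Z, hZ, hZs⟩ := O.support_elimination hX hY hne hXe hYe
  refine hK.2 Z hZ fun x hx ↦ ?_
  obtain ⟨h1, h2⟩ := hZs hx
  rcases h1 with h1 | h1
  · exact ((hXs h1).resolve_left h2).1
  · exact ((hYs h1).resolve_left h2).1

/-- The underlying matroid of an oriented matroid: its circuits are the underlying sets of the
signed circuits (see `toMatroid_isCircuit_iff`). -/
def toMatroid (O : OrientedMatroid α) : Matroid α :=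
  (IndepMatroid.ofFinite O.finite_ground O.Indep
    ⟨empty_subset _, fun X hX hs ↦ O.ne_zero X hX
      (Function.support_eq_empty_iff.1 (subset_empty_iff.1 hs))⟩
    (fun _ _ hJ h ↦ hJ.subset h)
    (fun _ _ hI hJ h ↦ O.indep_aug hI hJ h)
    (fun _ hI ↦ hI.1)).matroid

theorem toMatroid_isCircuit_iff (O : OrientedMatroid α) (C : Set α) :
    O.toMatroid.IsCircuit C ↔ ∃ X ∈ O.circuits, Function.support X = C := by
  have hind : ∀ I, O.toMatroid.Indep I ↔ O.Indep I := fun _ ↦ Iff.rfl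
  have hE : O.toMatroid.E = O.E := rfl
  have hdep : ∀ X ∈ O.circuits, O.toMatroid.Dep (Function.support X) := fun X hX ↦
    ⟨fun h ↦ ((hind _).1 h).2 X hX subset_rfl, O.support_subset_ground X hX⟩
  rw [Matroid.isCircuit_iff]
  constructor
  · rintro ⟨⟨h1, h2⟩, h3⟩
    obtain ⟨X, hX, hs⟩ := exists_circuit_of_not_indep (O := O) h2 h1
    exact ⟨X, hX, h3 (hdep X hX) hs⟩
  · rintro ⟨X, hX, rfl⟩
    refine ⟨hdep X hX, fun D hD hDX ↦ ?_⟩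
    obtain ⟨Y, hY, hs⟩ := exists_circuit_of_not_indep (O := O) hD.2 hD.1
    refine hDX.antisymm ?_
    rcases O.eq_or_eq_neg Y hY X hX (hs.trans hDX) with rfl | rfl
    · exact hs
    · rwa [support_neg_sign] at hs

/-! ### Minors -/

open Classical in
/-- The restriction of a signed set to the complement of `{a}`. -/
noncomputable def erase (a : α) (X : α → SignType) : α → SignType :=
  fun f ↦ if f = a then 0 else X f

theorem erase_self (a : α) (X : α → SignType) : erase a X a = 0 := by simp [erase]

theorem erase_of_ne {a f : α} (h : f ≠ a) (X : α → SignType) : erase a X f = X f := by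
  simp [erase, h]

theorem erase_neg (a : α) (X : α → SignType) : erase a (-X) = -erase a X := by
  ext f
  by_cases h : f = a <;> simp [erase, h]

theorem support_erase (a : α) (X : α → SignType) :
    Function.support (erase a X) = Function.support X \ {a} := by
  ext f
  by_cases h : f = a <;> simp [erase, h]

/-- The deletion `O \ a`: the signed circuits are those of `O` avoiding `a`. -/
def delete (O : OrientedMatroid α) (a : α) : OrientedMatroid α where
  E := O.E \ {a}
  finite_ground := O.finite_ground.subset sdiff_subset
  circuits := {X | X ∈ O.circuits ∧ X a = 0}
  support_subset_ground := by
    rintro X ⟨hX, ha⟩ f hf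
    refine ⟨O.support_subset_ground X hX hf, ?_⟩
    rintro rfl
    exact hf ha
  ne_zero := fun X hX ↦ O.ne_zero X hX.1
  neg_mem := fun X hX ↦ ⟨O.neg_mem X hX.1, by simp [hX.2]⟩
  eq_or_eq_neg := fun X hX Y hY h ↦ O.eq_or_eq_neg X hX.1 Y hY.1 h
  elimination := by
    rintro X ⟨hX, hXa⟩ Y ⟨hY, hYa⟩ hne e he he'
    obtain ⟨Z, hZ, hZe, hp, hn⟩ := O.elimination X hX Y hY hne e he he'
    refine ⟨Z, ⟨hZ, ?_⟩, hZe, hp, hn⟩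
    have key : ∀ s : SignType, (s = 1 → False) → (s = -1 → False) → s = 0 := by decide
    refine key _ (fun h ↦ ?_) (fun h ↦ ?_)
    · rcases hp a h with h | h <;> simp_all
    · rcases hn a h with h | h <;> simp_all

/-- The signed circuits of the contraction `O / a`: the nonzero restrictions `X \ a` of signed
circuits `X` of `O` whose underlying set is inclusion-minimal among all those. -/
def contractCircuits (O : OrientedMatroid α) (a : α) : Set (α → SignType) :=
  {Z | (∃ X ∈ O.circuits, Z = erase a X) ∧ Z ≠ 0 ∧
    ∀ Y ∈ O.circuits, erase a Y ≠ 0 →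
      Function.support (erase a Y) ⊆ Function.support Z →
        Function.support (erase a Y) = Function.support Z}

/-- A circuit of `O` that does not become a circuit of `O / a` still contains one conformally. -/
theorem exists_conformal (O : OrientedMatroid α) (a : α) {Z : α → SignType}
    (hZ : Z ∈ O.circuits) (hZ0 : erase a Z ≠ 0) :
    ∃ W ∈ O.contractCircuits a, ∀ f, W f ≠ 0 → W f = Z f := by
  by_cases hmem : erase a Z ∈ O.contractCircuits a
  · refine ⟨_, hmem, fun f hf ↦ erase_of_ne ?_ Z⟩
    rintro rfl
    exact hf (erase_self _ _)
  -- circuits below `Z` outside `a`, other than `± Z`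
  have hW0 : ∃ W ∈ O.circuits, erase a W ≠ 0 ∧
      Function.support (erase a W) ⊂ Function.support (erase a Z) := by
    by_contra! h
    exact hmem ⟨⟨Z, hZ, rfl⟩, hZ0, fun Y hY hY0 hs ↦ by
      by_contra hne
      exact h Y hY hY0 (hs.ssubset_of_ne hne)⟩
  have hZfin : (Function.support Z).Finite :=
    O.finite_ground.subset (O.support_subset_ground Z hZ)
  let P : Set (α → SignType) := {W | W ∈ O.circuits ∧ erase a W ≠ 0 ∧
      Function.support (erase a W) ⊂ Function.support (erase a Z)}
  have hcontains : ∀ W ∈ P, W a ≠ 0 ∧ Z a = 0 := by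
    rintro W ⟨hW, -, hs⟩
    rw [support_erase, support_erase] at hs
    have hnot : ¬ Function.support W ⊆ Function.support Z := by
      intro h
      have : Function.support W = Function.support Z := by
        rcases O.eq_or_eq_neg W hW Z hZ h with rfl | rfl
        · rfl
        · exact support_neg_sign Z
      rw [this] at hs
      exact hs.ne rfl
    obtain ⟨f, hfW, hfZ⟩ := not_subset.1 hnot
    have hfa : f = a := by
      by_contra hne
      exact hfZ (hs.subset ⟨hfW, hne⟩).1
    subst hfa
    exact ⟨hfW, by simpa using hfZ⟩
  obtain ⟨W, hWP, hmin⟩ := (InvImage.wf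
    (fun W : α → SignType ↦ {f | f ∈ Function.support Z ∧ W f = -Z f}.ncard)
    Nat.lt_wfRel.wf).has_min P hW0
  obtain ⟨hW, hWne, hWs⟩ := id hWP
  obtain ⟨hWa, hZa⟩ := hcontains W hWP
  have hWsub : ∀ f, f ≠ a → W f ≠ 0 → Z f ≠ 0 := by
    intro f hfa hfW
    have : f ∈ Function.support (erase a W) := by rw [support_erase]; exact ⟨hfW, hfa⟩
    have := hWs.subset this
    rw [support_erase] at this
    exact this.1
  have hZW : Z ≠ -W ∧ Z ≠ W := by
    constructor <;> rintro rfl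
    · simp at hZa; exact hWa hZa
    · exact hWa hZa
  refine ⟨erase a W, ⟨⟨W, hW, rfl⟩, hWne, fun Y hY hY0 hs ↦ ?_⟩, fun f hf ↦ ?_⟩
  · have hYP : Y ∈ P := ⟨hY, hY0, hs.trans_ssubset hWs⟩
    obtain ⟨hYa, -⟩ := hcontains Y hYP
    have hYW : Function.support Y ⊆ Function.support W := by
      intro f hf
      by_cases hfa : f = a
      · rw [hfa]; exact hWa
      · rw [support_erase, support_erase] at hs
        exact (hs ⟨hf, hfa⟩).1
    rcases O.eq_or_eq_neg Y hY W hW hYW with rfl | rfl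
    · rfl
    · rw [erase_neg, support_neg_sign]
  · -- otherwise elimination with `Z` removes a disagreement
    have hfa : f ≠ a := by rintro rfl; exact hf (erase_self _ _)
    rw [erase_of_ne hfa] at hf ⊢
    by_contra hdis
    have hfZ := hWsub f hfa hf
    have key : ∀ s t : SignType, s ≠ 0 → t ≠ 0 → s ≠ t → s = -t := by decide
    have hWf : W f = -Z f := key _ _ hf hfZ hdis
    obtain ⟨V, hV, hVf, hVs⟩ := O.elimination' hZ hW hZW.1 hfZ hWf
    have hVsub : ∀ x, x ≠ a → V x ≠ 0 → Z x ≠ 0 := by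
      intro x hxa hx
      rcases hVs x hx with h | h
      · rwa [← h]
      · exact hWsub x hxa (by rwa [← h])
    have hss : Function.support (erase a V) ⊂ Function.support (erase a Z) := by
      rw [support_erase, support_erase]
      refine ⟨fun x hx ↦ ⟨hVsub x hx.2 hx.1, hx.2⟩, fun h ↦ ?_⟩
      exact (h ⟨hfZ, hfa⟩).1 hVf
    by_cases hV0 : erase a V = 0
    · -- then `V` is supported on the single element `a`, which lies in `W`
      have hVW : Function.support V ⊆ Function.support W := by
        intro x hx
        by_cases hxa : x = a
        · rw [hxa]; exact hWa
        · exact absurd (by rw [← erase_of_ne hxa V, hV0]; rfl) hx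
      have hVW' : Function.support V = Function.support W := by
        rcases O.eq_or_eq_neg V hV W hW hVW with rfl | rfl
        · rfl
        · exact support_neg_sign W
      have : f ∈ Function.support V := by rw [hVW']; exact hf
      exact this hVf
    · refine hmin V ⟨hV, hV0, hss⟩ ?_
      refine ncard_lt_ncard ?_ (hZfin.subset fun x hx ↦ hx.1)
      refine ⟨fun x hx ↦ ⟨hx.1, ?_⟩, fun h ↦ ?_⟩
      · have hxZ : Z x ≠ 0 := hx.1
        have hVx : V x = -Z x := hx.2
        have key2 : ∀ s : SignType, s ≠ 0 → -s ≠ 0 ∧ -s ≠ s := by decide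
        rcases hVs x (by rw [hVx]; exact (key2 _ hxZ).1) with h | h
        · exact absurd (hVx.symm.trans h) (key2 _ hxZ).2
        · rw [← h, hVx]
      · have h2 : V f = -Z f := (h ⟨hfZ, hWf⟩).2
        rw [hVf] at h2
        have key3 : ∀ s : SignType, 0 = -s → s = 0 := by decide
        exact hfZ (key3 _ h2)

/-- The contraction `O / a`. -/
def contract (O : OrientedMatroid α) (a : α) : OrientedMatroid α where
  E := O.E \ {a}
  finite_ground := O.finite_ground.subset sdiff_subset
  circuits := O.contractCircuits a
  support_subset_ground := by
    rintro _ ⟨⟨X, hX, rfl⟩, -, -⟩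
    rw [support_erase]
    exact sdiff_subset_sdiff_left (O.support_subset_ground X hX)
  ne_zero := fun X hX ↦ hX.2.1
  neg_mem := by
    rintro _ ⟨⟨X, hX, rfl⟩, h0, hmin⟩
    refine ⟨⟨-X, O.neg_mem X hX, (erase_neg a X).symm⟩, fun h ↦ h0 ?_, ?_⟩
    · rw [← Function.support_eq_empty_iff, ← support_neg_sign, h, Function.support_zero]
    rwa [support_neg_sign]
  eq_or_eq_neg := by
    rintro _ ⟨⟨X, hX, rfl⟩, hX0, hXmin⟩ _ ⟨⟨Y, hY, rfl⟩, hY0, hYmin⟩ hs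
    have heq := hYmin X hX hX0 hs
    rw [support_erase, support_erase] at heq
    have key : Function.support X ⊆ Function.support Y ∨
        Function.support Y ⊆ Function.support X := by
      by_cases ha : Y a = 0
      · right
        intro f hf
        have hfa : f ≠ a := by rintro rfl; exact hf ha
        have : f ∈ Function.support X \ {a} := by rw [heq]; exact ⟨hf, hfa⟩
        exact this.1
      · left
        intro f hf
        by_cases hfa : f = a
        · rw [hfa]; exact ha
        · have : f ∈ Function.support Y \ {a} := by rw [← heq]; exact ⟨hf, hfa⟩
          exact this.1
    rcases key with h | h
    · rcases O.eq_or_eq_neg X hX Y hY h with rfl | rfl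
      · exact Or.inl rfl
      · exact Or.inr (erase_neg a Y)
    · rcases O.eq_or_eq_neg Y hY X hX h with rfl | rfl
      · exact Or.inl rfl
      · right; rw [erase_neg, neg_neg]
  elimination := by
    rintro _ ⟨⟨X, hX, rfl⟩, hX0, hXmin⟩ _ ⟨⟨Y, hY, rfl⟩, hY0, hYmin⟩ hne e he he'
    have hea : e ≠ a := by
      rintro rfl
      rw [erase_self] at he
      exact absurd he (by decide)
    rw [erase_of_ne hea] at he he'
    have hne' : X ≠ -Y := by
      rintro rfl
      exact hne (erase_neg a Y)
    obtain ⟨Z, hZ, hZe, hp, hn⟩ := O.elimination X hX Y hY hne' e he he'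
    have hZ0 : erase a Z ≠ 0 := by
      intro h0
      have hZsup : Function.support Z ⊆ {a} := by
        rw [← sdiff_eq_empty, ← support_erase, h0, Function.support_zero]
      have hZne := O.ne_zero Z hZ
      have hZa : Z a ≠ 0 := by
        intro ha
        apply hZne
        ext f
        by_contra hf
        have : f = a := hZsup hf
        exact hf (this ▸ ha)
      have hno : ∀ V ∈ O.circuits, V e ≠ 0 → V a = 0 := by
        intro V hV hVe
        by_contra hVa
        have hsub : Function.support Z ⊆ Function.support V := by
          intro f hf
          rw [show f = a from hZsup hf]
          exact hVa
        rcases O.eq_or_eq_neg Z hZ V hV hsub with rfl | rfl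
        · exact hVe hZe
        · have : (-V) e = 0 := hZe
          simp at this
          exact hVe this
      have hXa := hno X hX (by rw [he]; decide)
      have hYa := hno Y hY (by rw [he']; decide)
      have key : ∀ s : SignType, s ≠ 0 → s = 1 ∨ s = -1 := by decide
      rcases key _ hZa with h | h
      · rcases hp a h with h | h <;> simp_all
      · rcases hn a h with h | h <;> simp_all
    obtain ⟨W, hW, hconf⟩ := O.exists_conformal a hZ hZ0
    have hWa : W a = 0 := by
      obtain ⟨⟨V, -, rfl⟩, -, -⟩ := hW
      exact erase_self a V
    refine ⟨W, hW, ?_, fun f hf ↦ ?_, fun f hf ↦ ?_⟩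
    · by_contra h
      exact h ((hconf e h).trans hZe)
    · have hfa : f ≠ a := by rintro rfl; rw [hWa] at hf; exact absurd hf (by decide)
      rw [erase_of_ne hfa, erase_of_ne hfa]
      exact hp f (by rw [← hconf f (by rw [hf]; decide), hf])
    · have hfa : f ≠ a := by rintro rfl; rw [hWa] at hf; exact absurd hf (by decide)
      rw [erase_of_ne hfa, erase_of_ne hfa]
      exact hn f (by rw [← hconf f (by rw [hf]; decide), hf])

/-- `O'` is a minor of `O`: it arises from `O` by a finite sequence (possibly empty) of deletions
and contractions of elements. -/
def IsMinor (O' O : OrientedMatroid α) : Prop :=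
  Relation.ReflTransGen
    (fun P Q : OrientedMatroid α ↦ ∃ a ∈ P.E, Q = P.delete a ∨ Q = P.contract a) O O'

/-! ### Flows and coflows -/

/-- Signed sets `X`, `Y` are orthogonal if their supports are disjoint or there are elements of
the common support on which they agree and elements on which they disagree. -/
def Orthogonal (X Y : α → SignType) : Prop :=
  (∀ e, X e * Y e = 0) ∨ ((∃ e, X e * Y e = 1) ∧ ∃ f, X f * Y f = -1)

/-- The signed cocircuits of `O` (the signed circuits of the dual `O✶`): the signed sets supported
on a cocircuit of the underlying matroid that are orthogonal to all signed circuits. -/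
def cocircuits (O : OrientedMatroid α) : Set (α → SignType) :=
  {Y | O.toMatroid.IsCocircuit (Function.support Y) ∧ ∀ X ∈ O.circuits, Orthogonal X Y}

/-- The vector in `{0, 1, -1}^α ⊆ ℤ^α` of a signed set. -/
def signedVector (X : α → SignType) : α → ℤ := fun e ↦ (X e : ℤ)

/-- The flow lattice: integer combinations of the signed vectors of the signed circuits. -/
def flowLattice (O : OrientedMatroid α) : AddSubgroup (α → ℤ) :=
  AddSubgroup.closure (signedVector '' O.circuits)

/-- The coflow lattice: integer combinations of the signed vectors of the signed cocircuits. -/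
def coflowLattice (O : OrientedMatroid α) : AddSubgroup (α → ℤ) :=
  AddSubgroup.closure (signedVector '' O.cocircuits)

end OrientedMatroid

/-- `x` is a `{0, 1, -1}`-vector with one or two nonzero entries. -/
def IsSmallSignVector {α : Type u} (x : α → ℤ) : Prop :=
  (∀ e, x e = 0 ∨ x e = 1 ∨ x e = -1) ∧ x ≠ 0 ∧ (Function.support x).encard ≤ 2

namespace Matroid

variable {α : Type u}

/-- A matroid is simple if it has no loops and no parallel pairs, i.e. no circuit with at most
two elements. -/
def IsSimple (M : Matroid α) : Prop := ∀ C, M.IsCircuit C → 2 < C.encard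

/-- A matroid is cosimple if its dual is simple. -/
def IsCosimple (M : Matroid α) : Prop := M✶.IsSimple

/-- A matroid is orientable if it is the underlying matroid of an oriented matroid. -/
def Orientable (M : Matroid α) : Prop := ∃ O : OrientedMatroid α, O.toMatroid = M

/-- A double circuit: a set `D` with `r(D) = |D| - 2` and `r(D - d) = r(D)` for all `d ∈ D`. -/
def IsDoubleCircuit (M : Matroid α) (D : Set α) : Prop :=
  D ⊆ M.E ∧ M.eRk D + 2 = D.encard ∧ ∀ d ∈ D, M.eRk (D \ {d}) = M.eRk D

/-- The classes of the circuit partition of a double circuit `D`: the sets `Dᵢ ⊆ D` for which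
`D \ Dᵢ` is a circuit. -/
def circuitClasses (M : Matroid α) (D : Set α) : Set (Set α) :=
  {S | S ⊆ D ∧ M.IsCircuit (D \ S)}

/-- A copoint is a flat of codimension one. -/
def IsCopoint (M : Matroid α) (H : Set α) : Prop := M.IsFlat H ∧ M.eRk H + 1 = M.eRank

/-- A coline is a flat of codimension two. -/
def IsColine (M : Matroid α) (L : Set α) : Prop := M.IsFlat L ∧ M.eRk L + 2 = M.eRank

/-- The classes of the copoint partition of a coline `L`: the sets `H \ L` where `H` is a copoint
containing `L`. -/
def copointClasses (M : Matroid α) (L : Set α) : Set (Set α) :=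
  {S | ∃ H, M.IsCopoint H ∧ L ⊆ H ∧ S = H \ L}

end Matroid

/-- The parity condition on a partition `P` (of a double circuit, or of the complement of a
coline): the number of classes is even and some class is singular (has exactly one element), or
the number of classes is odd and at least two classes are singular. -/
def ParitySingular {α : Type u} (P : Set (Set α)) : Prop :=
  (Even P.ncard ∧ 1 ≤ {S ∈ P | S.ncard = 1}.ncard) ∨
    (Odd P.ncard ∧ 2 ≤ {S ∈ P | S.ncard = 1}.ncard)

namespace OrientedMatroid

variable {α : Type u}

/-- `O` is `GSP` if every simple minor with nonempty ground set has a `{0, 1, -1}`-coflow with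
one or two nonzero entries. -/
def IsGSP (O : OrientedMatroid α) : Prop :=
  ∀ O' : OrientedMatroid α, O'.IsMinor O → O'.E.Nonempty → O'.toMatroid.IsSimple →
    ∃ x ∈ O'.coflowLattice, IsSmallSignVector x

/-- `O` is `coGSP` if every cosimple minor with nonempty ground set has a `{0, 1, -1}`-flow with
one or two nonzero entries. -/
def IsCoGSP (O : OrientedMatroid α) : Prop :=
  ∀ O' : OrientedMatroid α, O'.IsMinor O → O'.E.Nonempty → O'.toMatroid.IsCosimple →
    ∃ x ∈ O'.flowLattice, IsSmallSignVector x

end OrientedMatroid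

/-! ## Alternating relations in an additive group -/

section Alternating

variable {A : Type*} [AddCommGroup A] {G : AddSubgroup A} {n : ℕ} {x : ℕ → A}

/-! Both halves reduce to one statement about a pencil of signed sets on a finite set `D`: the
signed circuits inside a double circuit, or the signed cocircuits supported off a coline. Up to
sign, the members of a pencil correspond to the classes of `D`, each member vanishing exactly on its
class.

Let `{a}` be a singular class and `W` the member vanishing there. Normalize the other members to be
`1` at `a`. Eliminating `a` between two of them returns `±W`, and the sign orders them linearly as
`Y 0, ..., Y (n-1)`: the member `Y i` is `0` on its own class `S i`, equals `W` on later classes and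
`-W` on earlier ones. Write `w i` for `W` cut down to `S i`. Then `Y i - Y (i+1) = w i + w (i+1)`,
`W` is the sum of all `w i`, and `Y 0 - W = e_a - w 0`, where `e_a` is the unit vector at `a`.
Modulo the lattice, therefore, `w i` is `(-1)^i e_a`. If the degree `n + 1` is even, the alternating
sum is `e_a`, which thus lies in the lattice. If instead there is a second singular class `{b}`, the
corresponding `w k` is a signed unit vector at `b`, and combining it with `±e_a` gives a vector with
two nonzero entries.

For circuits the pencil axioms are immediate from rank counts. For cocircuits, which are defined by
orthogonality, one must prove that every cocircuit carries a signature unique up to sign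
(`exists_orthogonal_signature`, `cocircuits_eq_or_eq_neg`) and that elimination holds around a
coline (`coline_elimination_aux`).

Since the class is minor-closed, the parity hypothesis applies directly to the minor in question.
Simple matroids of rank below two have a cocircuit with one element, which settles that case in both
halves. -/

theorem sub_neg_one_pow_smul_mem (h : ∀ i, i + 1 < n → x i + x (i + 1) ∈ G) :
    ∀ i < n, x i - (-1 : ℤ) ^ i • x 0 ∈ G := by
  intro i
  induction i with
  | zero => intro _; simp
  | succ i ih =>
    intro hi
    have := G.sub_mem (h i hi) (ih (by omega))
    convert this using 1
    rw [pow_succ, mul_neg_one, neg_smul]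
    abel

/-- Modulo `G` the terms alternate as `x 0, -x 0, x 0, ...`, so an odd number of them sums to `x 0`.
-/
theorem mem_of_odd_of_sum_mem (hn : Odd n) (h : ∀ i, i + 1 < n → x i + x (i + 1) ∈ G)
    (hsum : ∑ i ∈ Finset.range n, x i ∈ G) : x 0 ∈ G := by
  have h1 : ∑ i ∈ Finset.range n, (x i - (-1 : ℤ) ^ i • x 0) ∈ G :=
    G.sum_mem fun i hi ↦ sub_neg_one_pow_smul_mem h i (Finset.mem_range.1 hi)
  have h2 := G.sub_mem hsum h1
  rwa [Finset.sum_sub_distrib, sub_sub_cancel, ← Finset.sum_smul, neg_one_geom_sum,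
    if_neg (Nat.not_even_iff_odd.2 hn), one_smul] at h2

end Alternating

theorem exists_equiv_fin_of_isStrictTotalOrder {ι : Type*} [Finite ι] (r : ι → ι → Prop)
    [IsStrictTotalOrder ι r] : ∃ e : Fin (Nat.card ι) ≃ ι, ∀ i j, i < j → r (e i) (e j) := by
  classical
  let _ := linearOrderOfSTO r
  have _ := Fintype.ofFinite ι
  refine ⟨(monoEquivOfFin ι (Nat.card_eq_fintype_card).symm).toEquiv, fun i j hij ↦ ?_⟩
  exact (monoEquivOfFin ι (Nat.card_eq_fintype_card).symm).strictMono hij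

/-! ### Pencils of signed sets and their cyclic order -/

namespace OrientedMatroid

variable {α : Type u}

theorem sign_eq_or_eq_neg {s t : SignType} (hs : s ≠ 0) (ht : t ≠ 0) : s = t ∨ s = -t := by
  revert s t; decide

theorem sign_ne_neg_self {s : SignType} (hs : s ≠ 0) : s ≠ -s := by
  revert s; decide

theorem isSmallSignVector_single [DecidableEq α] (a : α) :
    IsSmallSignVector (Pi.single a (1 : ℤ)) := by
  refine ⟨fun e ↦ ?_, fun h ↦ ?_, ?_⟩
  · by_cases h : e = a
    · subst h; simp
    · simp [h]
  · simpa using congrFun h a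
  · refine (encard_le_encard (t := {a}) fun e he ↦ ?_).trans (by simp)
    by_contra h
    exact he (by simp [show e ≠ a from h])

theorem isSmallSignVector_pair {x : α → ℤ} {a b : α} (hx : ∀ e, x e = 0 ∨ x e = 1 ∨ x e = -1)
    (ha : x a ≠ 0) (h : ∀ e, e ≠ a → e ≠ b → x e = 0) : IsSmallSignVector x := by
  refine ⟨hx, fun h0 ↦ ha (congrFun h0 a), ?_⟩
  refine (encard_le_encard (t := {a, b}) fun e he ↦ ?_).trans ?_
  · by_contra hab
    simp only [mem_insert_iff, mem_singleton_iff, not_or] at hab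
    exact he (h e hab.1 hab.2)
  · refine (encard_insert_le _ _).trans ?_
    rw [encard_singleton, one_add_one_eq_two]

/-- The complements in `D` of the supports of the members of a family of signed sets. -/
def zeroClasses (D : Set α) (F : Set (α → SignType)) : Set (Set α) :=
  {S | S ⊆ D ∧ ∃ X ∈ F, Function.support X = D \ S}

/-- A family of signed sets with the properties of the signed circuits in a double circuit `D`,
or of the signed cocircuits in the complement `D` of a coline: weak elimination holds, and for
every `d ∈ D` there is up to sign exactly one member that vanishes at `d`. -/
structure IsPencil (D : Set α) (F : Set (α → SignType)) : Prop where
  finite : D.Finite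
  support_subset : ∀ X ∈ F, Function.support X ⊆ D
  neg_mem : ∀ X ∈ F, -X ∈ F
  elimination : ∀ X ∈ F, ∀ Y ∈ F, X ≠ -Y → ∀ e, X e ≠ 0 → Y e = -X e →
    ∃ Z ∈ F, Z e = 0 ∧ ∀ f, Z f ≠ 0 → Z f = X f ∨ Z f = Y f
  exists_apply_eq_zero : ∀ d ∈ D, ∃ X ∈ F, X d = 0
  eq_or_eq_neg : ∀ X ∈ F, ∀ Y ∈ F, ∀ d ∈ D, X d = 0 → Y d = 0 → X = Y ∨ X = -Y
  exists_zero : ∀ X ∈ F, ∃ d ∈ D, X d = 0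

namespace IsPencil

variable {D : Set α} {F : Set (α → SignType)}

theorem finite_zeroClasses (hF : IsPencil D F) : (zeroClasses D F).Finite :=
  hF.finite.finite_subsets.subset fun _ hS ↦ hS.1

theorem nonempty_of_mem (hF : IsPencil D F) {S : Set α} (hS : S ∈ zeroClasses D F) :
    S.Nonempty := by
  obtain ⟨hSD, X, hX, hs⟩ := hS
  obtain ⟨d, hd, hXd⟩ := hF.exists_zero X hX
  refine ⟨d, by_contra fun h ↦ ?_⟩
  have : d ∈ Function.support X := hs ▸ ⟨hd, h⟩
  exact this hXd

theorem eq_of_mem_of_mem (hF : IsPencil D F) {S T : Set α} (hS : S ∈ zeroClasses D F)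
    (hT : T ∈ zeroClasses D F) {d : α} (hdS : d ∈ S) (hdT : d ∈ T) : S = T := by
  obtain ⟨hSD, X, hX, hs⟩ := hS
  obtain ⟨hTD, Y, hY, ht⟩ := hT
  have hXd : X d = 0 := by
    by_contra h
    have : d ∈ D \ S := hs ▸ h
    exact this.2 hdS
  have hYd : Y d = 0 := by
    by_contra h
    have : d ∈ D \ T := ht ▸ h
    exact this.2 hdT
  have hsupp : Function.support X = Function.support Y := by
    rcases hF.eq_or_eq_neg X hX Y hY d (hSD hdS) hXd hYd with rfl | rfl
    · rfl
    · exact support_neg_sign Y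
  rw [hs, ht] at hsupp
  rw [← sdiff_sdiff_cancel_left hSD, hsupp, sdiff_sdiff_cancel_left hTD]

theorem exists_mem_zeroClasses (hF : IsPencil D F) {d : α} (hd : d ∈ D) :
    ∃ S ∈ zeroClasses D F, d ∈ S := by
  obtain ⟨X, hX, hXd⟩ := hF.exists_apply_eq_zero d hd
  refine ⟨D \ Function.support X, ⟨sdiff_subset, X, hX, ?_⟩, hd, fun h ↦ h hXd⟩
  rw [sdiff_sdiff_cancel_left (hF.support_subset X hX)]

theorem exists_normalized (hF : IsPencil D F) {S : Set α} (hS : S ∈ zeroClasses D F) {a : α}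
    (haD : a ∈ D) (haS : a ∉ S) : ∃ X ∈ F, Function.support X = D \ S ∧ X a = 1 := by
  obtain ⟨hSD, X, hX, hs⟩ := hS
  have hXa : X a ≠ 0 := by
    have : a ∈ Function.support X := hs ▸ ⟨haD, haS⟩
    exact this
  rcases sign_eq_or_eq_neg hXa one_ne_zero with h | h
  · exact ⟨X, hX, hs, h⟩
  · exact ⟨-X, hF.neg_mem X hX, by rw [support_neg_sign, hs], by simp [h]⟩

/-- The members of a pencil other than `W`, normalized at a zero `a` of `W`, are ordered
cyclically: this relation is a strict total order on them. -/
theorem compare (hF : IsPencil D F) {W X Y : α → SignType} (hW : W ∈ F) (hX : X ∈ F)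
    (hY : Y ∈ F) {a : α} (haD : a ∈ D) (hWa : W a = 0) (hXa : X a = 1) (hYa : Y a = 1)
    (hXY : X ≠ Y) :
    (∀ f, W f ≠ 0 → W f = X f ∨ W f = -Y f) ∨ (∀ f, W f ≠ 0 → W f = Y f ∨ W f = -X f) := by
  obtain ⟨Z, hZ, hZa, hZf⟩ := hF.elimination X hX (-Y) (hF.neg_mem Y hY)
    (by rwa [neg_neg]) a (by rw [hXa]; decide) (by simp [hXa, hYa])
  rcases hF.eq_or_eq_neg W hW Z hZ a haD hWa hZa with rfl | rfl
  · left
    exact hZf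
  · right
    intro f hf
    have hf' : Z f ≠ 0 := fun h ↦ hf (by simp [h])
    rcases hZf f hf' with h | h
    · right; simp [h]
    · left; simp [h]

/-- A pencil with a singular class `{a}`, in cyclic order starting from that class. -/
theorem exists_chain (hF : IsPencil D F) {a : α} (hA : {a} ∈ zeroClasses D F) :
    ∃ W ∈ F, Function.support W = D \ {a} ∧ ∃ (n : ℕ) (S : Fin n → Set α)
      (Y : Fin n → α → SignType), n + 1 = (zeroClasses D F).ncard ∧
      (∀ T, T ∈ zeroClasses D F ∧ T ≠ {a} ↔ ∃ i, S i = T) ∧ (∀ i, Y i ∈ F) ∧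
      (∀ i, Y i a = 1) ∧ (∀ i, ∀ f ∈ S i, Y i f = 0) ∧
      ∀ i j, i < j → (∀ f ∈ S j, Y i f = W f) ∧ ∀ f ∈ S i, Y j f = -W f := by
  have haD : a ∈ D := hA.1 rfl
  obtain ⟨-, W, hW, hWs⟩ := id hA
  have hWa : W a = 0 := by
    by_contra h
    have : a ∈ D \ {a} := hWs ▸ h
    exact this.2 rfl
  let ι := {T // T ∈ zeroClasses D F \ {{a}}}
  have : Finite ι := (hF.finite_zeroClasses.subset sdiff_subset).to_subtype
  have haS : ∀ T : ι, a ∉ T.1 := fun T h ↦ T.2.2 (hF.eq_of_mem_of_mem T.2.1 hA h rfl)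
  choose Y hYF hYs hYa using fun T : ι ↦ hF.exists_normalized T.2.1 haD (haS T)
  have hY0 : ∀ (T : ι), ∀ f ∈ T.1, Y T f = 0 := by
    intro T f hf
    by_contra h
    have : f ∈ D \ T.1 := hYs T ▸ h
    exact this.2 hf
  have hW0 : ∀ (T : ι), ∀ f ∈ T.1, W f ≠ 0 := by
    intro T f hf
    have : f ∈ Function.support W := by
      rw [hWs]
      exact ⟨T.2.1.1 hf, by rintro rfl; exact haS T hf⟩
    exact this
  have hYinj : ∀ S T : ι, S ≠ T → Y S ≠ Y T := by
    intro S T hST h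
    apply hST
    have h1 : D \ S.1 = D \ T.1 := by rw [← hYs, ← hYs, h]
    exact Subtype.ext (by
      rw [← sdiff_sdiff_cancel_left S.2.1.1, h1, sdiff_sdiff_cancel_left T.2.1.1])
  -- `W` is composed of values of `Y S` and `-Y T`, as happens when `W` is the outcome of
  -- eliminating `a` between these two.
  let r : ι → ι → Prop := fun S T ↦ S ≠ T ∧ ∀ f, W f ≠ 0 → W f = Y S f ∨ W f = -Y T f
  have hr1 : ∀ S T, r S T → ∀ f ∈ T.1, Y S f = W f := by
    rintro S T ⟨-, h⟩ f hf
    rcases h f (hW0 T f hf) with h | h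
    · exact h.symm
    · rw [hY0 T f hf, neg_zero] at h
      exact absurd h (hW0 T f hf)
  have hr2 : ∀ S T, r S T → ∀ f ∈ S.1, Y T f = -W f := by
    rintro S T ⟨-, h⟩ f hf
    rcases h f (hW0 S f hf) with h | h
    · rw [hY0 S f hf] at h
      exact absurd h (hW0 S f hf)
    · rw [h, neg_neg]
  have htot : ∀ S T, S ≠ T → r S T ∨ r T S := fun S T hST ↦
    (hF.compare hW (hYF S) (hYF T) haD hWa (hYa S) (hYa T) (hYinj S T hST)).imp
      (fun h ↦ ⟨hST, h⟩) fun h ↦ ⟨hST.symm, h⟩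
  have : IsStrictTotalOrder ι r :=
    { trichotomous := fun S T h h' ↦ by
        by_contra hST
        exact (htot S T hST).elim h h'
      irrefl := fun S h ↦ h.1 rfl
      -- Test at a point of the class `U`: there `Y T = W`, which forces `Y S = W`, whereas `S = U`
      -- would give `0` and `U` before `S` would give `-W`.
      trans := fun S T U hST hTU ↦ by
        obtain ⟨f, hf⟩ := hF.nonempty_of_mem U.2.1
        have hfW := hW0 U f hf
        have hT : Y T f = W f := hr1 T U hTU f hf
        have hS : Y S f = W f := by
          rcases hST.2 f hfW with h | h
          · exact h.symm
          · rw [hT] at h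
            exact absurd h (sign_ne_neg_self hfW)
        have hSU : S ≠ U := by
          rintro rfl
          rw [hY0 S f hf] at hS
          exact hfW hS.symm
        refine (htot S U hSU).resolve_right fun h ↦ ?_
        have := hr2 U S h f hf
        rw [hS] at this
        exact sign_ne_neg_self hfW this }
  obtain ⟨e, he⟩ := exists_equiv_fin_of_isStrictTotalOrder r
  refine ⟨W, hW, hWs, Nat.card ι, fun i ↦ (e i).1, fun i ↦ Y (e i), ?_, fun T ↦ ⟨fun hT ↦ ?_, ?_⟩,
    fun i ↦ hYF _, fun i ↦ hYa _, fun i ↦ hY0 _, fun i j hij ↦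
      ⟨hr1 _ _ (he i j hij), hr2 _ _ (he i j hij)⟩⟩
  · exact ncard_sdiff_singleton_add_one hA hF.finite_zeroClasses
  · exact ⟨e.symm ⟨T, hT⟩, by simp⟩
  · rintro ⟨i, rfl⟩
    exact (e i).2

open Classical in
/-- The part of a signed set on a subset, as an integer vector. -/
noncomputable def partVector (W : α → SignType) (S : Set α) : α → ℤ :=
  fun f ↦ if f ∈ S then (W f : ℤ) else 0

/-- The chain turns consecutive differences into sums of adjacent pieces of `W`; modulo the lattice
each piece is then `±` the unit vector at the singular class. -/
theorem exists_isSmallSignVector (hF : IsPencil D F) (hpar : ParitySingular (zeroClasses D F)) :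
    ∃ x ∈ AddSubgroup.closure (signedVector '' F), IsSmallSignVector x := by
  classical
  -- Both parity cases exclude a single class: one is not even, and two singular classes need degree
  -- at least two. This gives `n > 0` below.
  have hsing : ∃ a, {a} ∈ zeroClasses D F ∧ ((zeroClasses D F).ncard ≠ 1) ∧
      (Even (zeroClasses D F).ncard ∨ ∃ b, b ≠ a ∧ {b} ∈ zeroClasses D F) := by
    rcases hpar with ⟨heven, h1⟩ | ⟨-, h2⟩
    · obtain ⟨S, hS, hS1⟩ := nonempty_of_ncard_ne_zero (by omega :
        {S ∈ zeroClasses D F | S.ncard = 1}.ncard ≠ 0)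
      obtain ⟨a, rfl⟩ := ncard_eq_one.1 hS1
      exact ⟨a, hS, fun h ↦ by rw [h] at heven; exact absurd heven (by decide), Or.inl heven⟩
    · have hfin : {S ∈ zeroClasses D F | S.ncard = 1}.Finite :=
        hF.finite_zeroClasses.subset fun _ h ↦ h.1
      obtain ⟨S, T, ⟨hS, hS1⟩, ⟨hT, hT1⟩, hST⟩ := (one_lt_ncard_iff hfin).1 (by omega :
        1 < {S ∈ zeroClasses D F | S.ncard = 1}.ncard)
      obtain ⟨a, rfl⟩ := ncard_eq_one.1 hS1
      obtain ⟨b, rfl⟩ := ncard_eq_one.1 hT1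
      refine ⟨a, hS, fun h ↦ ?_, Or.inr ⟨b, ?_, hT⟩⟩
      · have := ncard_le_ncard (s := {S ∈ zeroClasses D F | S.ncard = 1})
          (t := zeroClasses D F) (fun _ h ↦ h.1) hF.finite_zeroClasses
        omega
      · rintro rfl
        exact hST rfl
  obtain ⟨a, hA, hcard, hab⟩ := hsing
  obtain ⟨W, hW, hWs, n, S, Y, hn, hS, hYF, hYa, hY0, hlt⟩ := hF.exists_chain hA
  have haD : a ∈ D := hA.1 rfl
  have hWa : W a = 0 := by
    by_contra h
    have : a ∈ D \ {a} := hWs ▸ h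
    exact this.2 rfl
  have hSP : ∀ i, S i ∈ zeroClasses D F := fun i ↦ ((hS (S i)).2 ⟨i, rfl⟩).1
  have haS : ∀ i, a ∉ S i := fun i h ↦
    ((hS (S i)).2 ⟨i, rfl⟩).2 (hF.eq_of_mem_of_mem (hSP i) hA h rfl)
  have hSne : ∀ i j, i < j → S i ≠ S j := by
    intro i j hij h
    obtain ⟨f, hf⟩ := hF.nonempty_of_mem (hSP i)
    have h1 := (hlt i j hij).2 f hf
    rw [hY0 j f (h ▸ hf)] at h1
    have : f ∈ Function.support W := by
      rw [hWs]
      exact ⟨(hSP i).1 hf, by rintro rfl; exact haS i hf⟩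
    exact this (by rw [← neg_neg (W f), ← h1, neg_zero])
  have hnot : ∀ i j, i ≠ j → ∀ f ∈ S i, f ∉ S j := by
    intro i j hij f hi hj
    have h := hF.eq_of_mem_of_mem (hSP i) (hSP j) hi hj
    rcases lt_or_gt_of_ne hij with h' | h'
    · exact hSne i j h' h
    · exact hSne j i h' h.symm
  have hcover : ∀ f ∈ D, f ≠ a → ∃ i, f ∈ S i := by
    intro f hf hfa
    obtain ⟨T, hT, hfT⟩ := hF.exists_mem_zeroClasses hf
    obtain ⟨i, rfl⟩ := (hS T).1 ⟨hT, by rintro rfl; exact hfa hfT⟩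
    exact ⟨i, hfT⟩
  have hout : ∀ X ∈ F, ∀ f, f ∉ D → X f = 0 := by
    intro X hX f hf
    by_contra h
    exact hf (hF.support_subset X hX h)
  set G := AddSubgroup.closure (signedVector '' F)
  have hG : ∀ X ∈ F, signedVector X ∈ G := fun X hX ↦
    AddSubgroup.subset_closure (mem_image_of_mem _ hX)
  have hpart0 : ∀ i, partVector W (S i) a = 0 := fun i ↦ by simp [partVector, haS i]
  -- The pieces of `W`, extended by zero past `n` so that they can be indexed by `ℕ`.
  let x : ℕ → α → ℤ := fun i ↦ if h : i < n then partVector W (S ⟨i, h⟩) else 0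
  have hx : ∀ i : Fin n, x i = partVector W (S i) := fun i ↦ by simp [x]
  have hn0 : 0 < n := by omega
  -- Consecutive members agree at `a` and on every class other than their own two; on those two
  -- their difference is `W`.
  have h1 : ∀ i, i + 1 < n → x i + x (i + 1) ∈ G := by
    intro i hi
    have hi' : i < n := by omega
    convert G.sub_mem (hG _ (hYF ⟨i, hi'⟩)) (hG _ (hYF ⟨i + 1, hi⟩)) using 1
    rw [hx ⟨i, hi'⟩, hx ⟨i + 1, hi⟩]
    generalize hp : (⟨i, hi'⟩ : Fin n) = p
    generalize hq : (⟨i + 1, hi⟩ : Fin n) = q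
    have hpq : p < q := by rw [← hp, ← hq, Fin.lt_def]; simp
    ext f
    simp only [Pi.add_apply, Pi.sub_apply, signedVector]
    by_cases hfD : f ∈ D
    swap
    · have : ∀ j, f ∉ S j := fun j h ↦ hfD ((hSP j).1 h)
      simp [partVector, this, hout _ (hYF _) f hfD]
    by_cases hfa : f = a
    · subst hfa
      simp [hpart0, hYa]
    obtain ⟨k, hk⟩ := hcover f hfD hfa
    rcases lt_trichotomy k p with h | h | h
    · have h' := h.trans hpq
      simp [partVector, hnot k p h.ne f hk, hnot k q h'.ne f hk, (hlt k p h).2 f hk,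
        (hlt k q h').2 f hk]
    · subst h
      simp [partVector, hk, hnot k q hpq.ne f hk, hY0 k f hk, (hlt k q hpq).2 f hk]
    rcases lt_trichotomy k q with h' | h' | h'
    · exfalso
      rw [← hp, Fin.lt_def] at h
      rw [← hq, Fin.lt_def] at h'
      simp only at h h'
      omega
    · subst h'
      simp [partVector, hk, hnot k p hpq.ne' f hk, hY0 k f hk, (hlt p k hpq).1 f hk]
    · simp [partVector, hnot k p h.ne' f hk, hnot k q h'.ne' f hk, (hlt p k h).1 f hk,
        (hlt q k h').1 f hk]
  have h2 : ∑ i ∈ Finset.range n, x i = signedVector W := by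
    rw [Finset.sum_range]
    ext f
    simp only [hx, Finset.sum_apply, signedVector]
    by_cases hfD : f ∈ D
    swap
    · have : ∀ j, f ∉ S j := fun j h ↦ hfD ((hSP j).1 h)
      simp [partVector, this, hout _ hW f hfD]
    by_cases hfa : f = a
    · subst hfa
      simp [hpart0, hWa]
    obtain ⟨k, hk⟩ := hcover f hfD hfa
    rw [Finset.sum_eq_single k]
    · simp [partVector, hk]
    · intro j _ hj
      simp [partVector, hnot k j hj.symm f hk]
    · simp
  -- The first member agrees with `W` off its own class and off `a`.
  have h3 : Pi.single a (1 : ℤ) - x 0 ∈ G := by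
    convert G.sub_mem (hG _ (hYF ⟨0, hn0⟩)) (hG _ hW) using 1
    rw [hx ⟨0, hn0⟩]
    generalize hp : (⟨0, hn0⟩ : Fin n) = p
    ext f
    simp only [Pi.sub_apply, signedVector]
    by_cases hfD : f ∈ D
    swap
    · have : ∀ j, f ∉ S j := fun j h ↦ hfD ((hSP j).1 h)
      have hfa : f ≠ a := by rintro rfl; exact hfD haD
      simp [partVector, this, hout _ (hYF _) f hfD, hout _ hW f hfD, hfa]
    by_cases hfa : f = a
    · subst hfa
      simp [hpart0, hYa, hWa]
    obtain ⟨k, hk⟩ := hcover f hfD hfa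
    have hpk : p ≤ k := by rw [← hp, Fin.le_def]; simp
    rcases hpk.lt_or_eq with h | h
    · simp [partVector, hfa, hnot k p h.ne' f hk, (hlt p k h).1 f hk]
    · subst h
      simp [partVector, hfa, hk, hY0 p f hk]
  rcases hab with heven | ⟨b, hba, hB⟩
  · have hodd : Odd n := by
      rw [← hn, Nat.even_add_one, Nat.not_even_iff_odd] at heven
      exact heven
    refine ⟨Pi.single a 1, ?_, isSmallSignVector_single a⟩
    simpa using G.add_mem h3 (mem_of_odd_of_sum_mem hodd h1 (h2 ▸ hG _ hW))
  -- The piece of `W` on `{b}` has a single entry `±1`, and it is congruent to `±` the unit vector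
  -- at `a`.
  · obtain ⟨k, hk⟩ := (hS {b}).1 ⟨hB, fun h ↦ hba (singleton_eq_singleton_iff.1 h)⟩
    have h4 := sub_neg_one_pow_smul_mem h1 k k.2
    rw [hx k, hk] at h4
    have h5 : partVector W {b} - (-1 : ℤ) ^ (k : ℕ) • Pi.single a (1 : ℤ) ∈ G := by
      convert G.sub_mem h4 (G.zsmul_mem h3 ((-1 : ℤ) ^ (k : ℕ))) using 1
      rw [smul_sub]
      abel
    have hε : (-1 : ℤ) ^ (k : ℕ) = 1 ∨ (-1 : ℤ) ^ (k : ℕ) = -1 := neg_one_pow_eq_or ℤ _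
    generalize (-1 : ℤ) ^ (k : ℕ) = ε at h5 hε
    have hab' : a ∉ ({b} : Set α) := fun h ↦ hba h.symm
    have hsign : ∀ s : SignType, (s : ℤ) = 0 ∨ (s : ℤ) = 1 ∨ (s : ℤ) = -1 := by decide
    refine ⟨_, h5, isSmallSignVector_pair (a := a) (b := b) (fun f ↦ ?_) ?_ fun f hfa hfb ↦ ?_⟩
    · by_cases hfa : f = a
      · subst hfa
        rcases hε with rfl | rfl <;> simp [partVector, hab']
      · by_cases hfb : f = b
        · simpa [partVector, hfb, hba] using hsign (W b)
        · simp [partVector, hfa, hfb]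
    · rcases hε with rfl | rfl <;> simp [partVector, hab']
    · simp [partVector, hfa, hfb]

end IsPencil

end OrientedMatroid

open scoped Matroid

namespace OrientedMatroid

variable {α : Type u}

/-! ## Minors and underlying matroids -/

theorem isCircuit_support (O : OrientedMatroid α) {X : α → SignType} (hX : X ∈ O.circuits) :
    O.toMatroid.IsCircuit (Function.support X) :=
  (O.toMatroid_isCircuit_iff _).2 ⟨X, hX, rfl⟩

theorem toMatroid_delete (O : OrientedMatroid α) (a : α) :
    (O.delete a).toMatroid = O.toMatroid ＼ {a} := by
  refine Matroid.ext_isCircuit rfl fun C _ ↦ ?_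
  rw [Matroid.delete_isCircuit_iff, toMatroid_isCircuit_iff, toMatroid_isCircuit_iff]
  constructor
  · rintro ⟨X, ⟨hX, hXa⟩, rfl⟩
    exact ⟨⟨X, hX, rfl⟩, by simpa using hXa⟩
  · rintro ⟨⟨X, hX, rfl⟩, h⟩
    exact ⟨X, ⟨hX, by simpa using h⟩, rfl⟩

/-- Two matroids agree once the circuits of each are dependent in the other. A circuit of the
matroid contraction lifts to a circuit of `O` that exceeds it at most by `a`, and `exists_conformal`
finds a signed circuit of `O.contract a` inside it. -/
theorem toMatroid_contract (O : OrientedMatroid α) (a : α) :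
    (O.contract a).toMatroid = O.toMatroid ／ {a} := by
  refine Matroid.ext_isCircuit_not_indep rfl (fun C hC ↦ ?_) fun C hC ↦ ?_
  · obtain ⟨_, ⟨⟨X, hX, rfl⟩, h0, -⟩, rfl⟩ := (toMatroid_isCircuit_iff _ _).1 hC
    rw [support_erase]
    refine ((O.isCircuit_support hX).contract_dep_of_not_subset fun h ↦ h0 ?_).not_indep
    rw [← Function.support_eq_empty_iff, support_erase, sdiff_eq_empty]
    exact h
  · obtain ⟨K, hK, hCK, hKC⟩ := hC.exists_subset_isCircuit_of_contract
    obtain ⟨X, hX, rfl⟩ := (toMatroid_isCircuit_iff _ _).1 hK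
    have haC : a ∉ C := fun h ↦ (hC.subset_ground h).2 rfl
    have hne : erase a X ≠ 0 := by
      obtain ⟨e, he⟩ := hC.nonempty
      intro h
      have h1 : e ∈ Function.support (erase a X) := by
        rw [support_erase]
        exact ⟨hCK he, by rintro rfl; exact haC he⟩
      rw [h] at h1
      exact h1 rfl
    obtain ⟨Z, hZ, hZX⟩ := O.exists_conformal a hX hne
    intro hI
    refine ((O.contract a).isCircuit_support hZ).not_indep (hI.subset fun f hf ↦ ?_)
    have hZa : Z a = 0 := by
      obtain ⟨⟨V, -, rfl⟩, -⟩ := hZ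
      exact erase_self a V
    have hfX : f ∈ Function.support X := by
      rw [Function.mem_support, ← hZX f hf]
      exact hf
    refine (hKC hfX).resolve_right ?_
    rintro rfl
    exact hf hZa

theorem IsMinor.toMatroid {O O' : OrientedMatroid α} (h : O'.IsMinor O) :
    O'.toMatroid.IsMinor O.toMatroid := by
  induction h with
  | refl => exact Matroid.IsMinor.refl
  | tail _ hQ ih =>
    obtain ⟨a, -, rfl | rfl⟩ := hQ
    · refine Matroid.IsMinor.trans ?_ ih
      rw [toMatroid_delete]
      exact ⟨∅, {a}, by simp⟩
    · refine Matroid.IsMinor.trans ?_ ih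
      rw [toMatroid_contract]
      exact ⟨{a}, ∅, by simp⟩

end OrientedMatroid

/-! ## Double circuits -/

namespace Matroid

variable {α : Type u} {M : Matroid α}

theorem IsCircuit.eRk_sdiff_singleton {C D : Set α} (hC : M.IsCircuit C) (hCD : C ⊆ D) {e : α}
    (he : e ∈ C) : M.eRk (D \ {e}) = M.eRk D := by
  have h : e ∈ M.closure (D \ {e}) :=
    M.closure_subset_closure (sdiff_subset_sdiff_left hCD)
      (hC.mem_closure_sdiff_singleton_of_mem he)
  rw [← M.eRk_closure_eq (D \ {e}), ← M.closure_insert_eq_of_mem_closure h, M.eRk_closure_eq,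
    insert_sdiff_singleton, insert_eq_of_mem (hCD he)]

namespace IsDoubleCircuit

variable {D : Set α}

theorem encard_sdiff_pair (hD : M.IsDoubleCircuit D) (hfin : D.Finite) {d e : α} (hd : d ∈ D)
    (he : e ∈ D) (hde : d ≠ e) : ((D \ {d}) \ {e}).encard = M.eRk D := by
  have h1 := encard_sdiff_singleton_add_one (s := D \ {d}) (a := e) ⟨he, hde.symm⟩
  have h2 := encard_sdiff_singleton_add_one hd
  have h3 := hD.2.1
  have h4 := hfin.encard_lt_top
  generalize ((D \ {d}) \ {e}).encard = x at *
  generalize (D \ {d}).encard = y at *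
  generalize D.encard = z at *
  generalize M.eRk D = r at *
  enat_to_nat
  omega

theorem exists_isCircuit (hD : M.IsDoubleCircuit D) (hfin : D.Finite) {d : α} (hd : d ∈ D) :
    ∃ C ⊆ D \ {d}, M.IsCircuit C := by
  refine Dep.exists_isCircuit_subset ?_
  rw [← eRk_lt_encard_iff_dep_of_finite (hfin.subset sdiff_subset) (sdiff_subset.trans hD.1),
    hD.2.2 d hd]
  have h2 := encard_sdiff_singleton_add_one hd
  have h3 := hD.2.1
  have h4 := hfin.encard_lt_top
  generalize (D \ {d}).encard = y at *
  generalize D.encard = z at *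
  generalize M.eRk D = r at *
  enat_to_nat
  omega

/-- `D \ {d}` has nullity one: deleting a further element of one circuit leaves `r(D)` elements of
rank `r(D)`, an independent set, so every other circuit must use that element. -/
theorem isCircuit_unique (hD : M.IsDoubleCircuit D) (hfin : D.Finite) {d : α} (hd : d ∈ D)
    {C C' : Set α} (hC : M.IsCircuit C) (hCD : C ⊆ D \ {d}) (hC' : M.IsCircuit C')
    (hCD' : C' ⊆ D \ {d}) : C = C' := by
  by_contra hne
  obtain ⟨e, he, he'⟩ : ∃ e ∈ C, e ∉ C' := by
    by_contra! h
    exact hne (hC.eq_of_subset_isCircuit hC' h)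
  have hind : M.Indep ((D \ {d}) \ {e}) := by
    rw [indep_iff_eRk_eq_encard_of_finite ((hfin.subset sdiff_subset).subset sdiff_subset),
      hC.eRk_sdiff_singleton hCD he, hD.2.2 d hd,
      hD.encard_sdiff_pair hfin hd (hCD he).1 (fun h ↦ (hCD he).2 h.symm)]
  exact hC'.not_indep (hind.subset fun f hf ↦ ⟨hCD' hf, by rintro rfl; exact he' hf⟩)

theorem not_isCircuit (hD : M.IsDoubleCircuit D) (hfin : D.Finite) : ¬ M.IsCircuit D := by
  intro h
  have h1 := h.eRk_add_one_eq
  have h2 := hD.2.1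
  have h4 := hfin.encard_lt_top
  generalize D.encard = z at *
  generalize M.eRk D = r at *
  enat_to_nat
  omega

end IsDoubleCircuit

end Matroid

namespace OrientedMatroid

variable {α : Type u}

theorem isPencil_of_isDoubleCircuit (O : OrientedMatroid α) {D : Set α}
    (hD : O.toMatroid.IsDoubleCircuit D) :
    IsPencil D {X | X ∈ O.circuits ∧ Function.support X ⊆ D} where
  finite := O.finite_ground.subset hD.1
  support_subset := fun _ hX ↦ hX.2
  neg_mem := fun X hX ↦ ⟨O.neg_mem X hX.1, by rw [support_neg_sign]; exact hX.2⟩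
  elimination := by
    rintro X ⟨hX, hXD⟩ Y ⟨hY, hYD⟩ hne e he hYe
    obtain ⟨Z, hZ, hZe, hZf⟩ := O.elimination' hX hY hne he hYe
    refine ⟨Z, ⟨hZ, fun f hf ↦ ?_⟩, hZe, hZf⟩
    rcases hZf f hf with h | h
    · exact hXD (by rw [Function.mem_support, ← h]; exact hf)
    · exact hYD (by rw [Function.mem_support, ← h]; exact hf)
  exists_apply_eq_zero := by
    intro d hd
    obtain ⟨C, hCD, hC⟩ := hD.exists_isCircuit (O.finite_ground.subset hD.1) hd
    obtain ⟨X, hX, rfl⟩ := (O.toMatroid_isCircuit_iff _).1 hC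
    refine ⟨X, ⟨hX, fun f hf ↦ (hCD hf).1⟩, ?_⟩
    by_contra h
    exact (hCD h).2 rfl
  eq_or_eq_neg := by
    rintro X ⟨hX, hXD⟩ Y ⟨hY, hYD⟩ d hd hXd hYd
    refine O.eq_or_eq_neg X hX Y hY (Eq.subset ?_)
    exact hD.isCircuit_unique (O.finite_ground.subset hD.1) hd (O.isCircuit_support hX)
      (fun f hf ↦ ⟨hXD hf, by rintro rfl; exact hf hXd⟩) (O.isCircuit_support hY)
      fun f hf ↦ ⟨hYD hf, by rintro rfl; exact hf hYd⟩
  exists_zero := by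
    rintro X ⟨hX, hXD⟩
    by_contra! h
    refine hD.not_isCircuit (O.finite_ground.subset hD.1) ?_
    rw [← hXD.antisymm h]
    exact O.isCircuit_support hX

/-! ## Contraction by a set -/

/-- If `X` uses `a`, a circuit that is smaller off `a` is contained in the support of `X`, so it is
`±X`. -/
theorem erase_mem_contractCircuits (O : OrientedMatroid α) {a : α} {X : α → SignType}
    (hX : X ∈ O.circuits) (hXa : X a ≠ 0) (h0 : erase a X ≠ 0) :
    erase a X ∈ O.contractCircuits a := by
  refine ⟨⟨X, hX, rfl⟩, h0, fun Y hY _ hs ↦ ?_⟩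
  have hYX : Function.support Y ⊆ Function.support X := by
    intro f hf
    by_cases hfa : f = a
    · rw [hfa]; exact hXa
    · rw [support_erase, support_erase] at hs
      exact (hs ⟨hf, hfa⟩).1
  rcases O.eq_or_eq_neg Y hY X hX hYX with rfl | rfl
  · rfl
  · rw [erase_neg, support_neg_sign]

/-- Every element of a signed circuit, except the contracted one, lies in a conformal signed
circuit of the contraction. -/
theorem exists_conformal_through (O : OrientedMatroid α) {a f : α} {Z : α → SignType}
    (hZ : Z ∈ O.circuits) (hfa : f ≠ a) (hf : Z f ≠ 0) :
    ∃ W ∈ O.contractCircuits a, W f = Z f ∧ ∀ g, W g ≠ 0 → W g = Z g := by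
  by_cases hmem : erase a Z ∈ O.contractCircuits a
  · refine ⟨_, hmem, erase_of_ne hfa Z, fun g hg ↦ erase_of_ne ?_ Z⟩
    rintro rfl
    exact hg (erase_self _ _)
  have hZ0 : erase a Z ≠ 0 := fun h ↦ hf (by rw [← erase_of_ne hfa Z, h]; rfl)
  have hZa : Z a = 0 := by
    by_contra h
    exact hmem (O.erase_mem_contractCircuits hZ h hZ0)
  obtain ⟨V, hV, hV0, hVZ⟩ : ∃ V ∈ O.circuits, erase a V ≠ 0 ∧
      Function.support (erase a V) ⊂ Function.support (erase a Z) := by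
    by_contra! h
    exact hmem ⟨⟨Z, hZ, rfl⟩, hZ0, fun Y hY hY0 hs ↦ by
      by_contra hne
      exact h Y hY hY0 (hs.ssubset_of_ne hne)⟩
  rw [support_erase, support_erase] at hVZ
  have hVa : V a ≠ 0 := by
    intro h
    have hsub : Function.support V ⊆ Function.support Z := fun g hg ↦
      (hVZ.subset ⟨hg, by rintro rfl; exact hg h⟩).1
    rcases O.eq_or_eq_neg V hV Z hZ hsub with rfl | rfl
    · exact hVZ.ne rfl
    · rw [support_neg_sign] at hVZ
      exact hVZ.ne rfl
  have hZC := O.isCircuit_support hZ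
  have hVC := O.isCircuit_support hV
  set D := insert a (Function.support Z) with hDdef
  have hVD : Function.support V ⊆ D := by
    intro g hg
    by_cases hga : g = a
    · exact Or.inl hga
    · exact Or.inr (hVZ.subset ⟨hg, hga⟩).1
  -- `V` passes through `a`, so adding `a` to the circuit `Z` does not raise the rank; every element
  -- of `D` lies in `V` or `Z`.
  have hD : O.toMatroid.IsDoubleCircuit D := by
    have haZ : a ∉ Function.support Z := fun h ↦ h hZa
    refine ⟨insert_subset (hVC.subset_ground hVa) hZC.subset_ground, ?_, fun d hd ↦ ?_⟩
    · rw [encard_insert_of_notMem haZ, ← hZC.eRk_add_one_eq, add_assoc, one_add_one_eq_two,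
        ← hVC.eRk_sdiff_singleton hVD hVa, hDdef, insert_sdiff_self_of_notMem haZ]
    · rcases hd with rfl | hd
      · exact hVC.eRk_sdiff_singleton hVD hVa
      · exact hZC.eRk_sdiff_singleton (subset_insert _ _) hd
  have hF := O.isPencil_of_isDoubleCircuit hD
  have haD : a ∈ D := Or.inl rfl
  have hDa : D \ {a} = Function.support Z := insert_sdiff_self_of_notMem fun h ↦ h hZa
  have hZF : Z ∈ {X | X ∈ O.circuits ∧ Function.support X ⊆ D} := ⟨hZ, subset_insert _ _⟩
  have hA : {a} ∈ zeroClasses D {X | X ∈ O.circuits ∧ Function.support X ⊆ D} :=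
    ⟨singleton_subset_iff.2 haD, Z, hZF, hDa.symm⟩
  -- the two neighbours of `Z` in the pencil in `D` cover `Z` conformally
  obtain ⟨W, hW, hWs, n, S, Y, -, hS, hYF, hYa, hY0, hlt⟩ := hF.exists_chain hA
  have hWa : W a = 0 := by
    by_contra h
    have : a ∈ D \ {a} := hWs ▸ h
    exact this.2 rfl
  have hcover : ∀ g, Z g ≠ 0 → ∃ i, g ∈ S i := by
    intro g hg
    obtain ⟨T, hT, hgT⟩ := hF.exists_mem_zeroClasses (d := g) (Or.inr hg)
    obtain ⟨i, rfl⟩ := (hS T).1 ⟨hT, by rintro rfl; exact hg (hgT ▸ hZa)⟩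
    exact ⟨i, hgT⟩
  have hYZ : ∀ i g, g ≠ a → Y i g ≠ 0 → Z g ≠ 0 := fun i g hga hg ↦
    ((hYF i).2 hg).resolve_left hga
  obtain ⟨f₁, hf₁a, hf₁⟩ : ∃ g, g ≠ a ∧ V g ≠ 0 := by
    obtain ⟨g, hg⟩ := Function.ne_iff.1 hV0
    have hga : g ≠ a := by rintro rfl; exact hg (erase_self _ _)
    exact ⟨g, hga, by rwa [erase_of_ne hga] at hg⟩
  obtain ⟨f₀, ⟨hf₀Z, hf₀a⟩, hf₀⟩ := exists_of_ssubset hVZ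
  have hf₀V : V f₀ = 0 := by
    by_contra h
    exact hf₀ ⟨h, hf₀a⟩
  obtain ⟨i₀, hi₀⟩ := hcover f₀ hf₀Z
  obtain ⟨i₁, hi₁⟩ := hcover f₁ (hVZ.subset ⟨hf₁, hf₁a⟩).1
  have hi : i₀ ≠ i₁ := by
    rintro rfl
    have hY1 := hY0 i₀ f₁ hi₁
    rcases hF.eq_or_eq_neg V ⟨hV, hVD⟩ _ (hYF i₀) f₀ (Or.inr hf₀Z) hf₀V (hY0 i₀ f₀ hi₀) with
      h | h
    · exact hf₁ (by rw [h, hY1])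
    · exact hf₁ (by rw [h, Pi.neg_apply, hY1, neg_zero])
  -- `V` is nonzero at `f₁` and zero at `f₀`, so these points of `Z` lie in different classes.
  have hn : 1 < n := by
    have h0 := i₀.2
    have h1 := i₁.2
    have h2 : (i₀ : ℕ) ≠ i₁ := fun h ↦ hi (Fin.ext h)
    omega
  -- Off `a`, the first member agrees with `W` except for zeros on the first class, and the negated
  -- last member except for zeros on the last class. As `n > 1`, one of them is nonzero at `f`.
  have main : ∃ T ∈ O.circuits, T a ≠ 0 ∧ T f = W f ∧ ∀ g, g ≠ a → T g ≠ 0 → T g = W g := by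
    obtain ⟨j, hj⟩ := hcover f hf
    by_cases hj0 : (j : ℕ) = 0
    · have hlast : ∀ k : Fin n, k ≠ ⟨n - 1, by omega⟩ → k < ⟨n - 1, by omega⟩ := by
        intro k hk
        have h1 : (k : ℕ) ≠ n - 1 := fun h ↦ hk (Fin.ext h)
        have h2 := k.2
        rw [Fin.lt_def]
        simp only
        omega
      refine ⟨-Y ⟨n - 1, by omega⟩, O.neg_mem _ (hYF _).1, by simp [hYa], ?_, fun g hga hg ↦ ?_⟩
      · rw [Pi.neg_apply, (hlt j _ (hlast j fun h ↦ ?_)).2 f hj, neg_neg]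
        rw [h] at hj0
        simp only at hj0
        omega
      · have hg' : Y ⟨n - 1, by omega⟩ g ≠ 0 := fun h ↦ hg (by simp [h])
        obtain ⟨k, hk⟩ := hcover g (hYZ _ g hga hg')
        by_cases hkl : k = ⟨n - 1, by omega⟩
        · subst hkl
          exact absurd (hY0 _ g hk) hg'
        · rw [Pi.neg_apply, (hlt k _ (hlast k hkl)).2 g hk, neg_neg]
    · have hfirst : ∀ k : Fin n, (k : ℕ) ≠ 0 → ⟨0, by omega⟩ < k := by
        intro k hk
        rw [Fin.lt_def]
        exact Nat.pos_of_ne_zero hk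
      refine ⟨Y ⟨0, by omega⟩, (hYF _).1, by simp [hYa], (hlt _ j (hfirst j hj0)).1 f hj,
        fun g hga hg ↦ ?_⟩
      obtain ⟨k, hk⟩ := hcover g (hYZ _ g hga hg)
      by_cases hk0 : (k : ℕ) = 0
      · have hk' : k = ⟨0, by omega⟩ := Fin.ext hk0
        exact absurd (hY0 _ g (hk' ▸ hk)) hg
      · exact (hlt _ k (hfirst k hk0)).1 g hk
  obtain ⟨T, hT, hTa, hTf, hTg⟩ : ∃ T ∈ O.circuits, T a ≠ 0 ∧ T f = Z f ∧
      ∀ g, g ≠ a → T g ≠ 0 → T g = Z g := by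
    obtain ⟨T, hT, hTa, hTf, hTg⟩ := main
    rcases hF.eq_or_eq_neg W hW Z hZF a haD hWa hZa with rfl | rfl
    · exact ⟨T, hT, hTa, hTf, hTg⟩
    · refine ⟨-T, O.neg_mem T hT, by simpa using hTa, by simp [hTf], fun g hga hg ↦ ?_⟩
      rw [Pi.neg_apply, hTg g hga fun h ↦ hg (by simp [h]), Pi.neg_apply, neg_neg]
  refine ⟨erase a T, O.erase_mem_contractCircuits hT hTa fun h ↦ hf ?_, ?_, fun g hg ↦ ?_⟩
  · rw [← hTf, ← erase_of_ne hfa T, h]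
    rfl
  · rw [erase_of_ne hfa, hTf]
  · have hga : g ≠ a := by rintro rfl; exact hg (erase_self _ _)
    rw [erase_of_ne hga] at hg ⊢
    exact hTg g hga hg

/-- The contraction by a finite set: every element of a signed circuit outside that set lies in a
conformal signed circuit of the contraction. -/
theorem exists_contract_set (O : OrientedMatroid α) {H : Set α} (hH : H.Finite) :
    ∃ Q : OrientedMatroid α, Q.toMatroid = O.toMatroid ／ H ∧
      ∀ X ∈ O.circuits, ∀ f ∉ H, X f ≠ 0 →
        ∃ Z ∈ Q.circuits, Z f = X f ∧ ∀ g, Z g ≠ 0 → Z g = X g := by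
  induction H, hH using Set.Finite.induction_on with
  | empty => exact ⟨O, by simp, fun X hX _ _ _ ↦ ⟨X, hX, rfl, fun _ _ ↦ rfl⟩⟩
  | @insert a H _ _ ih =>
    obtain ⟨Q, hQ, hconf⟩ := ih
    refine ⟨Q.contract a, ?_, fun X hX f hf hXf ↦ ?_⟩
    · rw [toMatroid_contract, hQ, Matroid.contract_contract, union_singleton]
    · obtain ⟨Z, hZ, hZf, hZX⟩ := hconf X hX f (fun h ↦ hf (Or.inr h)) hXf
      obtain ⟨W, hW, hWf, hWZ⟩ := Q.exists_conformal_through hZ (a := a)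
        (fun h ↦ hf (Or.inl h)) (by rwa [hZf])
      refine ⟨W, hW, hWf.trans hZf, fun g hg ↦ (hWZ g hg).trans (hZX g ?_)⟩
      rwa [← hWZ g hg]

end OrientedMatroid

/-! ## Existence and uniqueness of signatures of cocircuits -/

namespace Matroid

variable {α : Type u} {M : Matroid α} {K : Set α}

/-- Contracting the complement of `K` leaves a matroid of rank one: each singleton of `K` spans, and
a loop would meet the cocircuit `K` in one element. -/
theorem IsCocircuit.isCircuit_pair (hK : M.IsCocircuit K) {e f : α} (he : e ∈ K) (hf : f ∈ K)
    (hef : e ≠ f) : (M ／ (M.E \ K)).IsCircuit {e, f} := by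
  have hKE := hK.subset_ground
  have hK' : (M ／ (M.E \ K)).IsCocircuit K :=
    contract_isCocircuit_iff.2 ⟨hK, disjoint_sdiff_right⟩
  have hE : (M ／ (M.E \ K)).E = K := by
    rw [contract_ground, sdiff_sdiff_cancel_left hKE]
  have hsingle : ∀ C, (M ／ (M.E \ K)).IsCircuit C → ∀ x, C ≠ {x} := by
    rintro C hC x rfl
    have hx : x ∈ K := hE ▸ hC.subset_ground rfl
    exact hC.inter_isCocircuit_ne_singleton hK' (inter_eq_left.2 (singleton_subset_iff.2 hx))
  have hspan : (M ／ (M.E \ K)).Spanning {e} := by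
    have h : (M ／ (M.E \ K)).Coindep (K \ {e}) := hK'.isCircuit.sdiff_singleton_indep he
    have := h.compl_spanning
    rwa [hE, sdiff_sdiff_cancel_left (singleton_subset_iff.2 he)] at this
  have hcl : f ∈ (M ／ (M.E \ K)).closure {e} := by
    rw [hspan.closure_eq, hE]
    exact hf
  obtain ⟨C, hCs, hC, hfC⟩ := (mem_closure_iff_exists_isCircuit (by simpa using hef.symm)).1 hcl
  have heC : e ∈ C := by
    by_contra h
    refine hsingle C hC f (Subset.antisymm (fun x hx ↦ ?_) (singleton_subset_iff.2 hfC))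
    rcases hCs hx with h' | h'
    · exact h'
    · rw [mem_singleton_iff.1 h'] at hx
      exact absurd hx h
  rwa [show ({e, f} : Set α) = C from
    Subset.antisymm (by rintro x (rfl | rfl) <;> assumption) (by rwa [pair_comm])]

theorem IsCocircuit.exists_eq_pair (hK : M.IsCocircuit K) {C : Set α}
    (hC : (M ／ (M.E \ K)).IsCircuit C) {e : α} (he : e ∈ C) : ∃ f ∈ K, e ≠ f ∧ C = {e, f} := by
  have hE : (M ／ (M.E \ K)).E = K := by
    rw [contract_ground, sdiff_sdiff_cancel_left hK.subset_ground]
  have hCK : C ⊆ K := hE ▸ hC.subset_ground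
  have hK' : (M ／ (M.E \ K)).IsCocircuit K :=
    contract_isCocircuit_iff.2 ⟨hK, disjoint_sdiff_right⟩
  obtain ⟨f, hfC, hfe⟩ : ∃ f ∈ C, f ≠ e := by
    by_contra! h
    refine hC.inter_isCocircuit_ne_singleton hK' (e := e) ?_
    rw [inter_eq_left.2 hCK]
    exact Subset.antisymm (fun x hx ↦ h x hx) (singleton_subset_iff.2 he)
  refine ⟨f, hCK hfC, hfe.symm, ?_⟩
  exact ((hK.isCircuit_pair (hCK he) (hCK hfC) hfe.symm).eq_of_subset_isCircuit hC
    (by rintro x (rfl | rfl) <;> assumption)).symm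

end Matroid

namespace OrientedMatroid

variable {α : Type u}

theorem Orthogonal.exists_neg {X Y : α → SignType} (h : Orthogonal X Y) {e : α} (he : X e ≠ 0)
    (he' : Y e ≠ 0) : ∃ f, X f * Y f = -(X e * Y e) := by
  have key : ∀ s t : SignType, s ≠ 0 → t ≠ 0 → s * t = 1 ∨ s * t = -1 := by decide
  have key' : (1 : SignType) ≠ 0 ∧ (-1 : SignType) ≠ 0 := by decide
  rcases h with h | ⟨⟨f, hf⟩, g, hg⟩
  · have := h e
    rcases key _ _ he he' with h' | h' <;> rw [h'] at this
    · exact absurd this key'.1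
    · exact absurd this key'.2
  · rcases key _ _ he he' with h' | h'
    · exact ⟨g, by rw [h', hg]⟩
    · exact ⟨f, by rw [h', hf, neg_neg]⟩

/-- After contracting the complement of `K` all circuits are pairs, and their signs say which
elements are parallel and which antiparallel to a base element `e₀`; this dictates `Y`. A circuit of
`O` that meets `K` contains such a pair conformally, and the pair supplies both signs needed for
orthogonality. -/
theorem exists_orthogonal_signature (O : OrientedMatroid α) {K : Set α}
    (hK : O.toMatroid.IsCocircuit K) : ∃ Y ∈ O.cocircuits, Function.support Y = K := by
  obtain ⟨Q, hQ, hconf⟩ := O.exists_contract_set (H := O.toMatroid.E \ K)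
    (O.finite_ground.subset sdiff_subset)
  have hpair : ∀ e ∈ K, ∀ f ∈ K, e ≠ f → ∃ X ∈ Q.circuits, Function.support X = {e, f} := by
    intro e he f hf hef
    rw [← toMatroid_isCircuit_iff, hQ]
    exact hK.isCircuit_pair he hf hef
  have hpair' : ∀ X ∈ Q.circuits, ∀ e, X e ≠ 0 →
      ∃ f ∈ K, e ≠ f ∧ Function.support X = {e, f} := by
    intro X hX e he
    have := Q.isCircuit_support hX
    rw [hQ] at this
    exact hK.exists_eq_pair this he
  have hXK : ∀ X ∈ Q.circuits, ∀ e, X e ≠ 0 → e ∈ K := by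
    intro X hX e he
    have := (Q.isCircuit_support hX).subset_ground he
    rwa [hQ, Matroid.contract_ground, sdiff_sdiff_cancel_left hK.subset_ground] at this
  obtain ⟨e₀, he₀⟩ := hK.nonempty
  -- every other element is matched with `e₀` by a signed circuit of the contraction
  have hsig : ∀ f, ∃ s : SignType, (f ∈ K ↔ s ≠ 0) ∧ (f = e₀ → s = 1) ∧
      (f ∈ K → f ≠ e₀ → ∃ X ∈ Q.circuits, Function.support X = {e₀, f} ∧ X e₀ = 1 ∧ X f = -s) := by
    intro f
    by_cases hf : f ∈ K
    · by_cases hfe : f = e₀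
      · exact ⟨1, by simp [hf], fun _ ↦ rfl, fun _ h ↦ absurd hfe h⟩
      · obtain ⟨X, hX, hXs⟩ := hpair e₀ he₀ f hf (Ne.symm hfe)
        have hXe : X e₀ ≠ 0 := by
          have : e₀ ∈ Function.support X := hXs ▸ Or.inl rfl
          exact this
        have hXf : X f ≠ 0 := by
          have : f ∈ Function.support X := hXs ▸ Or.inr rfl
          exact this
        rcases sign_eq_or_eq_neg hXe one_ne_zero with h | h
        · exact ⟨-X f, by simp [hf, hXf], fun h ↦ absurd h hfe, fun _ _ ↦
            ⟨X, hX, hXs, h, by simp⟩⟩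
        · exact ⟨X f, by simp [hf, hXf], fun h ↦ absurd h hfe, fun _ _ ↦
            ⟨-X, Q.neg_mem X hX, by rw [support_neg_sign, hXs], by simp [h], by simp⟩⟩
    · exact ⟨0, by simp [hf], fun h ↦ absurd (h ▸ he₀) hf, fun h ↦ absurd h hf⟩
  choose Y hYK hY1 hYX using hsig
  have hYs : Function.support Y = K := by
    ext f
    exact (hYK f).symm
  have horth0 : ∀ X ∈ Q.circuits, ∀ f, X e₀ ≠ 0 → X f ≠ 0 → f ≠ e₀ →
      X f * Y f = -(X e₀ * Y e₀) := by
    intro X hX f hXe hXf hfe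
    obtain ⟨Z, hZ, hZs, hZe, hZf⟩ := hYX f (hXK X hX f hXf) hfe
    obtain ⟨g, hg, -, hXs⟩ := hpair' X hX e₀ hXe
    have hfg : f = g := by
      have : f ∈ Function.support X := hXf
      rw [hXs] at this
      exact this.resolve_left hfe
    subst hfg
    have hYe := hY1 e₀ rfl
    have hYf := (hYK f).1 hg
    have key : ∀ s : SignType, s ≠ 0 → -s * s = -1 := by decide
    rcases Q.eq_or_eq_neg X hX Z hZ (by rw [hXs, hZs]) with rfl | rfl
    · rw [hZe, hZf, hYe, key _ hYf]; rfl
    · rw [Pi.neg_apply, Pi.neg_apply, hZe, hZf, hYe, neg_mul, key _ hYf]; rfl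
  -- For a pair avoiding `e₀`, eliminating `e` against the pair `{e₀, e}` gives the pair `{e₀, f}`,
  -- and two uses of `horth0` combine.
  have horth : ∀ X ∈ Q.circuits, ∀ e f, X e ≠ 0 → X f ≠ 0 → e ≠ f →
      X f * Y f = -(X e * Y e) := by
    intro X hX e f hXe hXf hef
    by_cases h1 : e = e₀
    · subst h1
      exact horth0 X hX f hXe hXf hef.symm
    by_cases h2 : f = e₀
    · subst h2
      rw [horth0 X hX e hXf hXe h1, neg_neg]
    have hYe := (hYK e).1 (hXK X hX e hXe)
    have hYf := (hYK f).1 (hXK X hX f hXf)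
    obtain ⟨Z, hZ, hZs, hZe, hZ2⟩ := hYX e (hXK X hX e hXe) h1
    -- eliminate `e`
    obtain ⟨Z, hZ, hZs, hZe₀, hZe⟩ : ∃ Z ∈ Q.circuits, Function.support Z = {e₀, e} ∧
        Z e₀ ≠ 0 ∧ Z e = -X e := by
      have hZe0 : Z e ≠ 0 := by
        have : e ∈ Function.support Z := hZs ▸ Or.inr rfl
        exact this
      rcases sign_eq_or_eq_neg hZe0 hXe with h | h
      · exact ⟨-Z, Q.neg_mem Z hZ, by rw [support_neg_sign, hZs], by simp [hZe], by simp [h]⟩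
      · exact ⟨Z, hZ, hZs, by rw [hZe]; decide, h⟩
    have hZf : Z f = 0 := by
      by_contra h
      have : f ∈ Function.support Z := h
      rw [hZs] at this
      rcases this with h' | h'
      · exact h2 h'
      · exact hef h'.symm
    have hXe₀ : X e₀ = 0 := by
      obtain ⟨g, -, -, hXs⟩ := hpair' X hX e hXe
      by_contra h
      have h3 : e₀ ∈ Function.support X := h
      have h4 : f ∈ Function.support X := hXf
      rw [hXs] at h3 h4
      have h5 := h3.resolve_left (Ne.symm h1)
      have h6 := h4.resolve_left hef.symm
      exact h2 (h6.trans h5.symm)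
    obtain ⟨V, hV, hVe, hVs⟩ := Q.elimination' hX hZ (fun h ↦ by
      rw [h, Pi.neg_apply, hZf, neg_zero] at hXf
      exact hXf rfl) hXe hZe
    have hVsub : ∀ g, V g ≠ 0 → g = e₀ ∨ g = f := by
      intro g hg
      have hge : g ≠ e := by rintro rfl; exact hg hVe
      rcases hVs g hg with h | h
      · obtain ⟨g', -, -, hXs⟩ := hpair' X hX e hXe
        have h3 : g ∈ Function.support X := by rw [Function.mem_support, ← h]; exact hg
        have h4 : f ∈ Function.support X := hXf
        rw [hXs] at h3 h4
        exact Or.inr ((h3.resolve_left hge).trans (h4.resolve_left hef.symm).symm)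
      · have h3 : g ∈ Function.support Z := by rw [Function.mem_support, ← h]; exact hg
        rw [hZs] at h3
        exact Or.inl (h3.resolve_right hge)
    have hVef : V e₀ ≠ 0 ∧ V f ≠ 0 := by
      obtain ⟨g, hg⟩ := Function.ne_iff.1 (Q.ne_zero V hV)
      obtain ⟨g', -, hgg', hVs'⟩ := hpair' V hV g hg
      have hg' : V g' ≠ 0 := by
        have : g' ∈ Function.support V := hVs' ▸ Or.inr rfl
        exact this
      rcases hVsub g hg with rfl | rfl <;> rcases hVsub g' hg' with rfl | rfl
      · exact absurd rfl hgg'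
      · exact ⟨hg, hg'⟩
      · exact ⟨hg', hg⟩
      · exact absurd rfl hgg'
    have hV1 : V e₀ = Z e₀ := (hVs e₀ hVef.1).resolve_left fun h ↦ hVef.1 (h.trans hXe₀)
    have hV2 : V f = X f := (hVs f hVef.2).resolve_right fun h ↦ hVef.2 (h.trans hZf)
    have o1 := horth0 V hV f hVef.1 hVef.2 h2
    have o2 := horth0 Z hZ e hZe₀ (by rw [hZe]; simpa using hXe) h1
    rw [hV1, hV2] at o1
    rw [hZe] at o2
    rw [o1, ← o2, neg_mul]
  refine ⟨Y, ⟨by rwa [hYs], fun X hX ↦ ?_⟩, hYs⟩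
  by_cases hdisj : ∀ e, X e * Y e = 0
  · exact Or.inl hdisj
  push Not at hdisj
  obtain ⟨e, he⟩ := hdisj
  have hXe : X e ≠ 0 := fun h ↦ he (by rw [h, zero_mul])
  have hYe : Y e ≠ 0 := fun h ↦ he (by rw [h, mul_zero])
  obtain ⟨Z, hZ, hZe, hZX⟩ := hconf X hX e (fun h ↦ h.2 ((hYK e).2 hYe)) hXe
  have hZe0 : Z e ≠ 0 := by rwa [hZe]
  obtain ⟨f, -, hef, hZs⟩ := hpair' Z hZ e hZe0
  have hZf : Z f ≠ 0 := by
    have : f ∈ Function.support Z := hZs ▸ Or.inr rfl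
    exact this
  have h := horth Z hZ e f hZe0 hZf hef
  rw [hZX e hZe0, hZX f hZf] at h
  have key : ∀ s : SignType, s ≠ 0 → s = 1 ∨ s = -1 := by decide
  rcases key _ he with h' | h'
  · exact Or.inr ⟨⟨e, h'⟩, f, by rw [h, h']⟩
  · exact Or.inr ⟨⟨f, by rw [h, h', neg_neg]⟩, e, h'⟩

theorem neg_mem_cocircuits (O : OrientedMatroid α) {Y : α → SignType} (hY : Y ∈ O.cocircuits) :
    -Y ∈ O.cocircuits := by
  refine ⟨by rw [support_neg_sign]; exact hY.1, fun X hX ↦ ?_⟩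
  rcases hY.2 X hX with h | ⟨⟨e, he⟩, f, hf⟩
  · left
    intro e
    simp [h e]
  · right
    exact ⟨⟨f, by simp [hf]⟩, e, by simp [he]⟩

/-- For `e, f` in the common support some circuit meets that support exactly in `{e, f}`;
orthogonality to it fixes the sign at `f` from the sign at `e`. -/
theorem cocircuits_eq_or_eq_neg (O : OrientedMatroid α) {Y Y' : α → SignType}
    (hY : Y ∈ O.cocircuits) (hY' : Y' ∈ O.cocircuits)
    (h : Function.support Y = Function.support Y') : Y = Y' ∨ Y = -Y' := by
  obtain ⟨e, he⟩ := hY.1.nonempty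
  have hee : Y e ≠ 0 := he
  -- agreement at `e` forces agreement everywhere
  have main : ∀ Y' ∈ O.cocircuits, Function.support Y = Function.support Y' → Y e = Y' e →
      Y = Y' := by
    intro Y' hY' h hYe
    ext f
    by_cases hf : Y f = 0
    · have : f ∉ Function.support Y' := h ▸ fun h' ↦ h' hf
      rw [hf, Function.notMem_support.1 this]
    by_cases hef : e = f
    · rw [← hef, hYe]
    obtain ⟨C, hC, hsub, hCsub⟩ :=
      (hY.1.isCircuit_pair he hf hef).exists_subset_isCircuit_of_contract
    obtain ⟨X, hX, rfl⟩ := (O.toMatroid_isCircuit_iff _).1 hC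
    have hXe : X e ≠ 0 := hsub (Or.inl rfl)
    have hX0 : ∀ g, X g ≠ 0 → Y g ≠ 0 → g = e ∨ g = f := fun g hg hg' ↦
      (hCsub hg).resolve_right fun h' ↦ h'.2 hg'
    have hYY : ∀ Z, Orthogonal X Z → Function.support Y = Function.support Z → Z e ≠ 0 →
        X f * Z f = -(X e * Z e) := by
      intro Z hXZ hZ hZe
      obtain ⟨g, hg⟩ := hXZ.exists_neg hXe hZe
      have key : ∀ s t : SignType, s ≠ 0 → t ≠ 0 → -(s * t) ≠ 0 ∧ s * t ≠ -(s * t) := by decide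
      have hne := key _ _ hXe hZe
      have hXg : X g ≠ 0 := by
        intro h0
        rw [h0, zero_mul] at hg
        exact hne.1 hg.symm
      have hZg : g ∈ Function.support Z := by
        intro h0
        rw [h0, mul_zero] at hg
        exact hne.1 hg.symm
      rcases hX0 g hXg (by rw [← hZ] at hZg; exact hZg) with rfl | rfl
      · exact absurd hg hne.2
      · exact hg
    have h1 := hYY Y (hY.2 X hX) rfl hee
    have h2 := hYY Y' (hY'.2 X hX) h (by rwa [← hYe])
    rw [← hYe, ← h1] at h2
    have hXf : X f ≠ 0 := hsub (Or.inr rfl)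
    have key : ∀ s t t' : SignType, s ≠ 0 → s * t' = s * t → t = t' := by decide
    exact key _ _ _ hXf h2
  have hYe' : Y' e ≠ 0 := by
    rw [h] at he
    exact he
  rcases sign_eq_or_eq_neg hee hYe' with h' | h'
  · exact Or.inl (main Y' hY' h h')
  · exact Or.inr (main (-Y') (O.neg_mem_cocircuits hY') (by rw [support_neg_sign, h]) h')

end OrientedMatroid

/-! ## Copoints, colines and cocircuits -/

namespace Matroid

variable {α : Type u} {M : Matroid α}

theorem IsCocircuit.isCopoint_compl {K : Set α} (hK : M.IsCocircuit K) :
    M.IsCopoint (M.E \ K) := by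
  have hmin := isCocircuit_iff_minimal_compl_nonspanning.1 hK
  have hspan : ∀ x ∈ K, M.Spanning (insert x (M.E \ K)) := by
    intro x hx
    by_contra h
    have h1 : M.E \ (K \ {x}) = insert x (M.E \ K) := by
      rw [sdiff_sdiff_right, union_comm, inter_eq_right.2
        (singleton_subset_iff.2 (hK.subset_ground hx)), singleton_union]
    have h2 := hmin.le_of_le (y := K \ {x}) (by rwa [h1]) sdiff_subset
    exact (h2 hx).2 rfl
  have hcl : ∀ x ∈ K, x ∉ M.closure (M.E \ K) := by
    intro x hx h
    refine hmin.prop ?_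
    rw [spanning_iff_closure_eq, ← closure_insert_eq_of_mem_closure h, (hspan x hx).closure_eq]
  refine ⟨?_, ?_⟩
  · rw [isFlat_iff_closure_eq]
    refine Subset.antisymm (fun x hx ↦ ?_) (M.subset_closure _)
    exact ⟨M.closure_subset_ground _ hx, fun h ↦ hcl x h hx⟩
  · obtain ⟨x, hx⟩ := hK.nonempty
    rw [← eRk_insert_eq_add_one ⟨hK.subset_ground hx, hcl x hx⟩, (hspan x hx).eRk_eq]

theorem IsCopoint.isCocircuit_compl [M.RankFinite] {H : Set α} (hH : M.IsCopoint H) :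
    M.IsCocircuit (M.E \ H) := by
  have hHE := hH.1.subset_ground
  rw [isCocircuit_iff_minimal_compl_nonspanning, minimal_iff_forall_lt]
  refine ⟨fun h ↦ ?_, fun K hK h ↦ h ?_⟩
  · rw [sdiff_sdiff_cancel_left hHE] at h
    have h1 := h.eRk_eq
    have h2 := hH.2
    -- Finite rank matters here: `r + 1 = r` is contradictory only for finite `r`.
    obtain ⟨n, hn⟩ := ENat.ne_top_iff_exists.1 (M.eRank_ne_top_iff.2 inferInstance)
    rw [h1, ← hn] at h2
    norm_cast at h2
    omega
  · obtain ⟨x, hx, hxK⟩ := exists_of_ssubset hK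
    rw [spanning_iff_eRk_le, ← hH.2, ← eRk_insert_eq_add_one (e := x)
      (by rwa [hH.1.closure])]
    exact M.eRk_mono (insert_subset ⟨hx.1, hxK⟩ fun y hy ↦ ⟨hHE hy, fun h ↦ (hK.1 h).2 hy⟩)

/-- The formula `r*(X) + r(M) = r(E \ X) + |X|` turns corank two of `L` into nullity two of its
complement in the dual. Thus the uniqueness results on double circuits apply to cocircuits. -/
theorem IsColine.isDoubleCircuit_compl [M.Finite] {L : Set α} (hL : M.IsColine L) :
    M✶.IsDoubleCircuit (M.E \ L) := by
  have hLE := hL.1.subset_ground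
  have h1 := M.eRk_dual_add_eRank (M.E \ L) sdiff_subset
  rw [sdiff_sdiff_cancel_left hLE, ← hL.2] at h1
  have hfin : (M.E \ L).Finite := M.ground_finite.subset sdiff_subset
  have h2 := hfin.encard_lt_top
  have h3 : M.eRk L < ⊤ :=
    (M.eRk_le_encard L).trans_lt (M.ground_finite.subset hLE).encard_lt_top
  have hr : M✶.eRk (M.E \ L) + 2 = (M.E \ L).encard := by
    generalize M✶.eRk (M.E \ L) = x at *
    generalize M.eRk L = y at *
    generalize (M.E \ L).encard = z at *
    enat_to_nat
    omega
  refine ⟨sdiff_subset, hr, fun d hd ↦ ?_⟩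
  have h4 := M.eRk_dual_add_eRank ((M.E \ L) \ {d}) (sdiff_subset.trans sdiff_subset)
  have h5 : M.E \ ((M.E \ L) \ {d}) = insert d L := by
    rw [Set.sdiff_sdiff_right, sdiff_sdiff_cancel_left hLE, inter_eq_right.2
      (singleton_subset_iff.2 hd.1), union_singleton]
  rw [h5, eRk_insert_eq_add_one ⟨hd.1, by rw [hL.1.closure]; exact hd.2⟩, ← hL.2] at h4
  have h6 := encard_sdiff_singleton_add_one hd
  generalize M✶.eRk (M.E \ L) = x at *
  generalize M✶.eRk ((M.E \ L) \ {d}) = x' at *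
  generalize M.eRk L = y at *
  generalize ((M.E \ L) \ {d}).encard = z' at *
  generalize (M.E \ L).encard = z at *
  enat_to_nat
  omega

/-- `E \ K` is a copoint containing `L` and `e` but not `t`, so `L`, `e` and `t` span, and `f`
closes a circuit with them. -/
theorem IsColine.exists_isCircuit [M.Finite] {L K : Set α} (hL : M.IsColine L)
    (hK : M.IsCocircuit K) (hKL : K ⊆ M.E \ L) {e t f : α} (he : e ∈ M.E \ L) (heK : e ∉ K)
    (ht : t ∈ K) (hf : f ∈ M.E \ L) (hfe : f ≠ e) (hft : f ≠ t) :
    ∃ C ⊆ insert f (insert t (insert e L)), M.IsCircuit C ∧ f ∈ C := by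
  have hLE := hL.1.subset_ground
  have hsub : insert e L ⊆ M.E \ K :=
    insert_subset ⟨he.1, heK⟩ fun x hx ↦ ⟨hLE hx, fun h ↦ (hKL h).2 hx⟩
  have ht' : t ∉ M.closure (insert e L) := by
    intro h
    have h1 := M.closure_subset_closure hsub h
    rw [hK.isCopoint_compl.1.closure] at h1
    exact h1.2 ht
  have htE := hK.subset_ground ht
  have hspan : M.Spanning (insert t (insert e L)) := by
    rw [spanning_iff_eRk_le (insert_subset htE (insert_subset he.1 hLE)),
      eRk_insert_eq_add_one ⟨htE, ht'⟩,
      eRk_insert_eq_add_one ⟨he.1, by rw [hL.1.closure]; exact he.2⟩, add_assoc,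
      one_add_one_eq_two, hL.2]
  refine (mem_closure_iff_exists_isCircuit ?_).1 (hspan.closure_eq ▸ hf.1)
  simp [hfe, hft, hf.2]

/-- A cocircuit that contains `e` can have no second element `f`, because `{e, f}` is independent by
simplicity and would force rank two. Applied to the dual, this gives a circuit with one element. -/
theorem IsSimple.exists_isCocircuit_singleton (hM : M.IsSimple) (hne : M.E.Nonempty)
    (hr : ¬ 2 ≤ M.eRank) : ∃ e, M.IsCocircuit {e} := by
  have hpair : ∀ e ∈ M.E, ∀ f ∈ M.E, M.Indep {e, f} := by
    intro e he f hf
    by_contra h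
    obtain ⟨C, hC, hCc⟩ := ((not_indep_iff (pair_subset he hf)).1 h).exists_isCircuit_subset
    refine absurd (hM C hCc) (not_lt.2 ((encard_le_encard hC).trans ?_))
    refine (encard_insert_le _ _).trans ?_
    rw [encard_singleton, one_add_one_eq_two]
  obtain ⟨e, he⟩ := hne
  obtain ⟨K, hK, hKe⟩ := (hpair e he e he).exists_isCocircuit_inter_eq_mem (e := e) (by simp)
  refine ⟨e, ?_⟩
  convert hK
  rw [← hKe]
  refine inter_eq_left.2 fun f hf ↦ ?_
  by_contra hfe
  have hef : e ≠ f := fun h ↦ hfe (by simp [h])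
  refine hr ?_
  rw [← encard_pair hef]
  exact (hpair e he f (hK.subset_ground hf)).encard_le_eRank

end Matroid

/-! ### The pencil of signed cocircuits around a coline -/

namespace OrientedMatroid

variable {α : Type u}

instance (O : OrientedMatroid α) : O.toMatroid.Finite := ⟨O.finite_ground⟩

/-- Elimination for three cocircuits vanishing on a coline, at an element where the second of the
given ones does not vanish. -/
theorem coline_elimination_aux (O : OrientedMatroid α) {L : Set α} (hL : O.toMatroid.IsColine L)
    {X Y Z : α → SignType} (hX : X ∈ O.cocircuits) (hXL : Function.support X ⊆ O.toMatroid.E \ L)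
    (hY : Y ∈ O.cocircuits) (hYL : Function.support Y ⊆ O.toMatroid.E \ L)
    (hZ : Z ∈ O.cocircuits) (hZL : Function.support Z ⊆ O.toMatroid.E \ L) {e t f : α}
    (hZe : Z e = 0) (hXe : X e ≠ 0) (hYe : Y e = -X e) (hYt : Y t = 0) (hXt : X t ≠ 0)
    (hZt : Z t = X t) (hYf : Y f ≠ 0) (hZf : Z f ≠ 0) : Z f = X f ∨ Z f = Y f := by
  by_contra! hcon
  have hZY : Z f = -Y f := (sign_eq_or_eq_neg hZf hYf).resolve_left hcon.2
  have hYe0 : Y e ≠ 0 := by rw [hYe]; simpa using hXe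
  have hZt0 : Z t ≠ 0 := by rwa [hZt]
  have hfe : f ≠ e := by rintro rfl; exact hZf hZe
  have hft : f ≠ t := by rintro rfl; exact hYf hYt
  -- A signed circuit in `L` together with `e`, `t`, `f` meets the three cocircuits only in these
  -- points. Orthogonality to `Z` and `Y` makes its products with `X` at `t` and `e` equal, so
  -- orthogonality to `X` forces the opposite product at `f`.
  obtain ⟨C, hCsub, hC, hfC⟩ := hL.exists_isCircuit hZ.1 hZL (hXL hXe) (fun h ↦ h hZe) hZt0
    (hZL hZf) hfe hft
  obtain ⟨V, hV, rfl⟩ := (O.toMatroid_isCircuit_iff _).1 hC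
  have hVf : V f ≠ 0 := hfC
  have hmem : ∀ T : α → SignType, Function.support T ⊆ O.toMatroid.E \ L → ∀ g, V g * T g ≠ 0 →
      g = f ∨ g = t ∨ g = e := by
    intro T hT g hg
    have hVg : V g ≠ 0 := fun h ↦ hg (by rw [h, zero_mul])
    have hTg : T g ≠ 0 := fun h ↦ hg (by rw [h, mul_zero])
    rcases hCsub hVg with h | h | h | h
    · exact Or.inl h
    · exact Or.inr (Or.inl h)
    · exact Or.inr (Or.inr h)
    · exact absurd h (hT hTg).2
  have hmul : ∀ s t : SignType, s ≠ 0 → t ≠ 0 → -(s * t) ≠ 0 ∧ s * t ≠ -(s * t) := by decide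
  have h1 : V t * Z t = -(V f * Z f) := by
    obtain ⟨g, hg⟩ := (hZ.2 V hV).exists_neg hVf hZf
    have hne := hmul _ _ hVf hZf
    rcases hmem Z hZL g (by rw [hg]; exact hne.1) with rfl | rfl | rfl
    · exact absurd hg hne.2
    · exact hg
    · rw [hZe, mul_zero] at hg
      exact absurd hg.symm hne.1
  have h2 : V e * Y e = -(V f * Y f) := by
    obtain ⟨g, hg⟩ := (hY.2 V hV).exists_neg hVf hYf
    have hne := hmul _ _ hVf hYf
    rcases hmem Y hYL g (by rw [hg]; exact hne.1) with rfl | rfl | rfl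
    · exact absurd hg hne.2
    · rw [hYt, mul_zero] at hg
      exact absurd hg.symm hne.1
    · exact hg
  have h3 : V t * X t = V f * Y f := by
    rw [← hZt, h1, hZY, mul_neg, neg_neg]
  have h4 : V e * X e = V f * Y f := by
    rw [hYe, mul_neg] at h2
    exact neg_injective h2
  have hVt : V t ≠ 0 := by
    intro h
    rw [h, zero_mul] at h3
    exact (hmul _ _ hVf hYf).1 (by rw [← h3, neg_zero])
  obtain ⟨g, hg⟩ := (hX.2 V hV).exists_neg hVt hXt
  have hne := hmul _ _ hVt hXt
  rcases hmem X hXL g (by rw [hg]; exact hne.1) with rfl | rfl | rfl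
  · have key : ∀ s t t' : SignType, s ≠ 0 → s * t' = s * t → t = t' := by decide
    refine hcon.1 (key _ _ _ hVf ?_)
    rw [hg, h3, hZY, mul_neg]
  · exact hne.2 hg
  · rw [h4, ← h3] at hg
    exact hne.2 hg

/-- Existence and uniqueness come from the dual double circuit and the signature results. For
elimination at `e` the only candidate, up to sign, is the member vanishing at `e`; its sign is fixed
at a point where `Y` vanishes and `X` does not. -/
theorem isPencil_of_isColine (O : OrientedMatroid α) {L : Set α} (hL : O.toMatroid.IsColine L) :
    IsPencil (O.toMatroid.E \ L)
      {Y | Y ∈ O.cocircuits ∧ Function.support Y ⊆ O.toMatroid.E \ L} := by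
  have hD := hL.isDoubleCircuit_compl
  have hfin : (O.toMatroid.E \ L).Finite := O.finite_ground.subset sdiff_subset
  have huniq : ∀ X, X ∈ O.cocircuits ∧ Function.support X ⊆ O.toMatroid.E \ L →
      ∀ Y, Y ∈ O.cocircuits ∧ Function.support Y ⊆ O.toMatroid.E \ L →
      ∀ d ∈ O.toMatroid.E \ L, X d = 0 → Y d = 0 → X = Y ∨ X = -Y := by
    rintro X ⟨hX, hXL⟩ Y ⟨hY, hYL⟩ d hd hXd hYd
    refine O.cocircuits_eq_or_eq_neg hX hY ?_
    exact hD.isCircuit_unique hfin hd hX.1.isCircuit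
      (fun f hf ↦ ⟨hXL hf, by rintro rfl; exact hf hXd⟩) hY.1.isCircuit
      fun f hf ↦ ⟨hYL hf, by rintro rfl; exact hf hYd⟩
  have hex : ∀ d ∈ O.toMatroid.E \ L, ∃ Y, (Y ∈ O.cocircuits ∧
      Function.support Y ⊆ O.toMatroid.E \ L) ∧ Y d = 0 := by
    intro d hd
    obtain ⟨C, hCD, hC⟩ := hD.exists_isCircuit hfin hd
    obtain ⟨Y, hY, rfl⟩ := O.exists_orthogonal_signature (K := C) hC
    refine ⟨Y, ⟨hY, fun f hf ↦ (hCD hf).1⟩, ?_⟩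
    by_contra h
    exact (hCD h).2 rfl
  refine ⟨hfin, fun _ hX ↦ hX.2, fun X hX ↦ ⟨O.neg_mem_cocircuits hX.1, by
    rw [support_neg_sign]; exact hX.2⟩, ?_, hex, huniq, ?_⟩
  · rintro X ⟨hX, hXL⟩ Y ⟨hY, hYL⟩ hne e hXe hYe
    have hYe0 : Y e ≠ 0 := by rw [hYe]; simpa using hXe
    have hXY : ¬ (X = Y ∨ X = -Y) := by
      rintro (h | h)
      · rw [← h] at hYe
        exact sign_ne_neg_self hXe hYe
      · exact hne h
    have hsupp : Function.support X ≠ Function.support Y := fun h ↦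
      hXY (O.cocircuits_eq_or_eq_neg hX hY h)
    obtain ⟨t, hXt, hYt⟩ : ∃ t, X t ≠ 0 ∧ Y t = 0 := by
      by_contra! h
      exact hsupp (hX.1.isCircuit.eq_of_subset_isCircuit hY.1.isCircuit h)
    obtain ⟨s, hYs, hXs⟩ : ∃ s, Y s ≠ 0 ∧ X s = 0 := by
      by_contra! h
      exact hsupp (hY.1.isCircuit.eq_of_subset_isCircuit hX.1.isCircuit h).symm
    have hZne : ∀ Z, (Z ∈ O.cocircuits ∧ Function.support Z ⊆ O.toMatroid.E \ L) → Z e = 0 →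
        Z t ≠ 0 ∧ Z s ≠ 0 := by
      refine fun Z hZ hZe ↦ ⟨fun h ↦ ?_, fun h ↦ ?_⟩
      · rcases huniq Y ⟨hY, hYL⟩ Z hZ t (hXL hXt) hYt h with rfl | rfl
        · exact hYe0 hZe
        · exact hYe0 (by simp [hZe])
      · rcases huniq X ⟨hX, hXL⟩ Z hZ s (hYL hYs) hXs h with rfl | rfl
        · exact hXe hZe
        · exact hXe (by simp [hZe])
    obtain ⟨Z, ⟨hZ, hZL⟩, hZe, hZt⟩ : ∃ Z, (Z ∈ O.cocircuits ∧
        Function.support Z ⊆ O.toMatroid.E \ L) ∧ Z e = 0 ∧ Z t = X t := by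
      obtain ⟨Z, hZ, hZe⟩ := hex e (hXL hXe)
      rcases sign_eq_or_eq_neg (hZne Z hZ hZe).1 hXt with h | h
      · exact ⟨Z, hZ, hZe, h⟩
      · exact ⟨-Z, ⟨O.neg_mem_cocircuits hZ.1, by rw [support_neg_sign]; exact hZ.2⟩,
          by simp [hZe], by simp [h]⟩
    have hZs0 := (hZne Z ⟨hZ, hZL⟩ hZe).2
    -- This is the normalization needed to exchange the roles of `X` and `Y`, for points where `Y`
    -- vanishes.
    have hZs : Z s = Y s := by
      refine (O.coline_elimination_aux hL hX hXL hY hYL hZ hZL hZe hXe hYe hYt hXt hZt hYs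
        hZs0).resolve_left fun h ↦ hZs0 (h.trans hXs)
    refine ⟨Z, ⟨hZ, hZL⟩, hZe, fun f hf ↦ ?_⟩
    by_cases hYf : Y f = 0
    · have hXf : X f ≠ 0 := fun h ↦ hXY (huniq X ⟨hX, hXL⟩ Y ⟨hY, hYL⟩ f (hZL hf) h hYf)
      exact (O.coline_elimination_aux hL hY hYL hX hXL hZ hZL hZe hYe0 (by rw [hYe, neg_neg])
        hXs hYs hZs hXf hf).symm
    · exact O.coline_elimination_aux hL hX hXL hY hYL hZ hZL hZe hXe hYe hYt hXt hZt hYf hf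
  · rintro X ⟨hX, hXL⟩
    by_contra! h
    refine hD.not_isCircuit hfin ?_
    rw [← hXL.antisymm h]
    exact hX.1.isCircuit

/-! ### From pencils to small flows and coflows -/

theorem zeroClasses_circuits_eq (O : OrientedMatroid α) (D : Set α) :
    zeroClasses D {X | X ∈ O.circuits ∧ Function.support X ⊆ D} =
      O.toMatroid.circuitClasses D := by
  ext S
  simp only [zeroClasses, Matroid.circuitClasses, toMatroid_isCircuit_iff]
  refine and_congr_right fun _ ↦ ⟨?_, ?_⟩
  · rintro ⟨X, ⟨hX, -⟩, hs⟩
    exact ⟨X, hX, hs⟩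
  · rintro ⟨X, hX, hs⟩
    exact ⟨X, ⟨hX, hs ▸ sdiff_subset⟩, hs⟩

/-- Copoints are the complements of cocircuits, and every cocircuit carries a signature. -/
theorem zeroClasses_cocircuits_eq (O : OrientedMatroid α) {L : Set α} (hL : L ⊆ O.toMatroid.E) :
    zeroClasses (O.toMatroid.E \ L)
      {Y | Y ∈ O.cocircuits ∧ Function.support Y ⊆ O.toMatroid.E \ L} =
      O.toMatroid.copointClasses L := by
  ext S
  constructor
  · rintro ⟨hS, Y, ⟨hY, hYL⟩, hs⟩
    refine ⟨_, hY.1.isCopoint_compl, fun x hx ↦ ⟨hL hx, fun h ↦ (hYL h).2 hx⟩, ?_⟩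
    rw [sdiff_sdiff_comm, hs, sdiff_sdiff_cancel_left hS]
  · rintro ⟨H, hH, hLH, rfl⟩
    refine ⟨sdiff_subset_sdiff_left hH.1.subset_ground, ?_⟩
    obtain ⟨Y, hY, hs⟩ := O.exists_orthogonal_signature hH.isCocircuit_compl
    have h : O.toMatroid.E \ H = (O.toMatroid.E \ L) \ (H \ L) := by
      ext x
      simp only [mem_sdiff]
      have := @hLH x
      tauto
    exact ⟨Y, ⟨hY, by rw [hs, h]; exact sdiff_subset⟩, by rw [hs, h]⟩

theorem isSmallSignVector_signedVector {X : α → SignType} {e : α}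
    (hX : Function.support X = {e}) : IsSmallSignVector (signedVector X) := by
  have hsign : ∀ s : SignType, (s : ℤ) = 0 ∨ (s : ℤ) = 1 ∨ (s : ℤ) = -1 := by decide
  have hsign' : ∀ s : SignType, s ≠ 0 → (s : ℤ) ≠ 0 := by decide
  refine isSmallSignVector_pair (a := e) (b := e) (fun f ↦ hsign _) (hsign' _ ?_) fun f hf _ ↦ ?_
  · have : e ∈ Function.support X := hX ▸ rfl
    exact this
  · have : f ∉ Function.support X := hX ▸ hf
    simp [signedVector, Function.notMem_support.1 this]

theorem exists_small_flow (O : OrientedMatroid α) (hne : O.E.Nonempty)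
    (hsimple : O.toMatroid.IsCosimple)
    (h : 2 ≤ O.toMatroid✶.eRank → ∃ D, O.toMatroid.IsDoubleCircuit D ∧
      ParitySingular (O.toMatroid.circuitClasses D)) :
    ∃ x ∈ O.flowLattice, IsSmallSignVector x := by
  by_cases hr : 2 ≤ O.toMatroid✶.eRank
  · obtain ⟨D, hD, hpar⟩ := h hr
    rw [← zeroClasses_circuits_eq] at hpar
    obtain ⟨x, hx, hsmall⟩ := (O.isPencil_of_isDoubleCircuit hD).exists_isSmallSignVector hpar
    exact ⟨x, AddSubgroup.closure_mono (image_mono fun _ hX ↦ hX.1) hx, hsmall⟩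
  · obtain ⟨e, he⟩ := Matroid.IsSimple.exists_isCocircuit_singleton hsimple hne hr
    obtain ⟨X, hX, hs⟩ :=
      (O.toMatroid_isCircuit_iff _).1 (Matroid.dual_isCocircuit_iff.1 he)
    exact ⟨_, AddSubgroup.subset_closure (mem_image_of_mem _ hX),
      isSmallSignVector_signedVector hs⟩

theorem exists_small_coflow (O : OrientedMatroid α) (hne : O.E.Nonempty)
    (hsimple : O.toMatroid.IsSimple)
    (h : 2 ≤ O.toMatroid.eRank → ∃ L, O.toMatroid.IsColine L ∧
      ParitySingular (O.toMatroid.copointClasses L)) :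
    ∃ x ∈ O.coflowLattice, IsSmallSignVector x := by
  by_cases hr : 2 ≤ O.toMatroid.eRank
  · obtain ⟨L, hL, hpar⟩ := h hr
    rw [← O.zeroClasses_cocircuits_eq hL.1.subset_ground] at hpar
    obtain ⟨x, hx, hsmall⟩ := (O.isPencil_of_isColine hL).exists_isSmallSignVector hpar
    exact ⟨x, AddSubgroup.closure_mono (image_mono fun _ hX ↦ hX.1) hx, hsmall⟩
  · obtain ⟨e, he⟩ := hsimple.exists_isCocircuit_singleton hne hr
    obtain ⟨Y, hY, hs⟩ := O.exists_orthogonal_signature he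
    exact ⟨_, AddSubgroup.subset_closure (mem_image_of_mem _ hY),
      isSmallSignVector_signedVector hs⟩

end OrientedMatroid

theorem proposition4p4 {α : Type u} (C : Set (Matroid α))
    (hminor : ∀ M ∈ C, ∀ N : Matroid α, N.IsMinor M → N ∈ C)
    (horientable : ∀ M ∈ C, M.Orientable) :
    ((∀ M ∈ C, M.IsCosimple → 2 ≤ M✶.eRank →
        ∃ D, M.IsDoubleCircuit D ∧ ParitySingular (M.circuitClasses D)) →
      ∀ O : OrientedMatroid α, O.toMatroid ∈ C → O.IsCoGSP) ∧
    ((∀ M ∈ C, M.IsSimple → 2 ≤ M.eRank →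
        ∃ L, M.IsColine L ∧ ParitySingular (M.copointClasses L)) →
      ∀ O : OrientedMatroid α, O.toMatroid ∈ C → O.IsGSP) :=
  ⟨fun h O hO O' hO' hne hs ↦
    O'.exists_small_flow hne hs (h _ (hminor _ hO _ hO'.toMatroid) hs),
  fun h O hO O' hO' hne hs ↦
    O'.exists_small_coflow hne hs (h _ (hminor _ hO _ hO'.toMatroid) hs)⟩
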